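/- Let $N$ be a smooth $5$-dimensional pseudo-Riemannian manifold (of any signature) with constant sectional curvature $c\in\mathbb{R}$, let $M$ be a smooth $4$-dimensional pseudo-Riemannian manifold (of any signature), and let $f:M\to N$ be a smooth isometric immersion, i.e. $M$ is a nondegenerate hypersurface of $N$. For a unit normal vector $\xi$ at a point ($\langle\xi,\xi\rangle=\pm1$), let $A_\xi$ be the shape operator, given by $\langle A_\xi X,Y\rangle=\langle B(X,Y),\xi\rangle$, where $B$ is the vector-valued second fundamental form; the principal curvatures at that point are the complex eigenvalues of $A_\xi$. Let $\vec H=\frac14\operatorname{tr}B$ be the mean curvature vector field. Suppose that (i) $f$ is biharmonic: its bitension field $\tau_2(f)=-\Delta\tau(f)-\operatorname{tr}\tilde R(df,\tau(f))\,df$ vanishes, where $\tau(f)=\operatorname{tr}B=4\vec H$ is the tension field, $\Delta=-\operatorname{tr}\tilde\nabla^2$ is the rough Laplacian on vector fields along $f$, and $\tilde R$ is the curvature tensor of $N$, with $\tilde R(X,Y)=[\tilde\nabla_X,\tilde\nabla_Y]-\tilde\nabla_{[X,Y]}$ (as $N$ has constant curvature $c$, this says $\Delta\vec H=4c\,\vec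 H$); (ii) at every point of $M$ there are exactly two distinct principal curvatures, and both are imaginary (i.e. not real). Then $M$ is minimal, i.e. $\vec H=0$ everywhere on $M$. -/

import Mathlib

open scoped Manifold ContDiff

set_option maxSynthPendingDepth 3

noncomputable section

namespace PseudoRiemannian

/-! ### Local tensor calculus in coordinates

A metric on an open piece of `ℝⁿ` is a field `G` of bilinear forms. All definitions of this section
are used only near points where `G` is smooth, symmetric and nondegenerate. -/

/-- The coordinate space `ℝⁿ`. -/
abbrev Coord (n : ℕ) : Type := EuclideanSpace ℝ (Fin n)

/-- Bilinear forms on `ℝⁿ`. -/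
abbrev Form (n : ℕ) : Type := Coord n →L[ℝ] Coord n →L[ℝ] ℝ

/-- The Koszul expression of constant vector fields `u, v, z`:
`½ (∂_u G(v, z) + ∂_v G(u, z) - ∂_z G(u, v))` at `y`. -/
def koszul {n : ℕ} (G : Coord n → Form n) (y : Coord n) :
    Coord n →L[ℝ] Coord n →L[ℝ] Coord n →L[ℝ] ℝ :=
  let D : Coord n →L[ℝ] Coord n →L[ℝ] Coord n →L[ℝ] ℝ := fderiv ℝ G y
  let T : (Coord n →L[ℝ] Coord n →L[ℝ] ℝ) →L[ℝ] (Coord n →L[ℝ] Coord n →L[ℝ] ℝ) :=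
    (ContinuousLinearMap.flipₗᵢ ℝ (Coord n) (Coord n) ℝ).toContinuousLinearEquiv
  (1 / 2 : ℝ) • (D + D.flip - T.comp D.flip)

theorem koszul_apply {n : ℕ} (G : Coord n → Form n) (y u v z : Coord n) :
    koszul G y u v z =
      (1 / 2 : ℝ) * (fderiv ℝ G y u v z + fderiv ℝ G y v u z - fderiv ℝ G y z u v) := by
  simp [koszul]

/-- The Christoffel symbols as a bilinear map: `Γ_y(u, v) = ∇_u v` at `y` for constant vector
fields `u, v`, where `∇` is the Levi-Civita connection of `G`; that is,
`G_y(Γ_y(u, v), z) = ½ (∂_u G(v, z) + ∂_v G(u, z) - ∂_z G(u, v))` for all `z`. -/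
def christoffel {n : ℕ} (G : Coord n → Form n) (y : Coord n) :
    Coord n →L[ℝ] Coord n →L[ℝ] Coord n :=
  (ContinuousLinearMap.compL ℝ (Coord n) (Coord n →L[ℝ] ℝ) (Coord n) (G y).inverse).comp
    (koszul G y)

theorem christoffel_apply {n : ℕ} (G : Coord n → Form n) (y u v : Coord n) :
    christoffel G y u v = (G y).inverse (koszul G y u v) := rfl

/-- The curvature tensor `R(u, v)w = ∇_u ∇_v w - ∇_v ∇_u w - ∇_{[u, v]} w` at `y`,
computed with the constant fields `u, v, w`. -/
def curvature {n : ℕ} (G : Coord n → Form n) (y u v w : Coord n) : Coord n :=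
  fderiv ℝ (fun y' => christoffel G y' v w) y u - fderiv ℝ (fun y' => christoffel G y' u w) y v
    + christoffel G y u (christoffel G y v w) - christoffel G y v (christoffel G y u w)

/-- The trace `∑ gⁱʲ B(∂_j, ∂_i)` of a bilinear map `B` with respect to `g` at `x`;
`(g x).inverse (dxⁱ) = ∑ⱼ gⁱʲ ∂_j`. -/
def metricTrace {m n : ℕ} (g : Coord m → Form m) (x : Coord m)
    (B : Coord m → Coord m → Coord n) : Coord n :=
  ∑ i : Fin m, B ((g x).inverse (EuclideanSpace.proj i)) (EuclideanSpace.single i (1 : ℝ))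

/-- The second fundamental form of a map `φ : (ℝᵐ, g) → (ℝⁿ, G)`,
`B(u, v) = ∇̃_u (dφ v) - dφ (∇_u v) = ∂_u ∂_v φ + Γ̃(dφ u, dφ v) - dφ (Γ(u, v))`. For an isometric
immersion it is the normal part of `∇̃_u (dφ v)`, that is `h(u, v) ξ` in the Gauss formula. -/
def secondFundamentalForm {m n : ℕ} (g : Coord m → Form m) (G : Coord n → Form n)
    (φ : Coord m → Coord n) (x : Coord m) : Coord m →L[ℝ] Coord m →L[ℝ] Coord n :=
  fderiv ℝ (fderiv ℝ φ) x
    + (christoffel G (φ x)).bilinearComp (fderiv ℝ φ x) (fderiv ℝ φ x)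
    - (ContinuousLinearMap.compL ℝ (Coord m) (Coord m) (Coord n) (fderiv ℝ φ x)).comp
        (christoffel g x)

theorem secondFundamentalForm_apply {m n : ℕ} (g : Coord m → Form m) (G : Coord n → Form n)
    (φ : Coord m → Coord n) (x u v : Coord m) :
    secondFundamentalForm g G φ x u v = fderiv ℝ (fderiv ℝ φ) x u v
      + christoffel G (φ x) (fderiv ℝ φ x u) (fderiv ℝ φ x v)
      - fderiv ℝ φ x (christoffel g x u v) := rfl

/-- The tension field `τ(φ) = trace B`. -/
def tension {m n : ℕ} (g : Coord m → Form m) (G : Coord n → Form n)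
    (φ : Coord m → Coord n) (x : Coord m) : Coord n :=
  metricTrace g x (fun u v => secondFundamentalForm g G φ x u v)

/-- The mean curvature vector field `(1/m) trace B`. -/
def meanCurvatureVector {m n : ℕ} (g : Coord m → Form m) (G : Coord n → Form n)
    (φ : Coord m → Coord n) (x : Coord m) : Coord n :=
  (m : ℝ)⁻¹ • tension g G φ x

/-- The covariant derivative `∇̃_u V = ∂_u V + Γ̃(dφ u, V)` of a vector field `V` along `φ`. -/
def covDerivAlong {m n : ℕ} (G : Coord n → Form n) (φ V : Coord m → Coord n)
    (x u : Coord m) : Coord n :=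
  fderiv ℝ V x u + christoffel G (φ x) (fderiv ℝ φ x u) (V x)

/-- The second covariant derivative `∇̃_u ∇̃_v V - ∇̃_{∇_u v} V` of a vector field `V` along `φ`. -/
def covHessianAlong {m n : ℕ} (g : Coord m → Form m) (G : Coord n → Form n)
    (φ V : Coord m → Coord n) (x u v : Coord m) : Coord n :=
  covDerivAlong G φ (fun x' => covDerivAlong G φ V x' v) x u
    - covDerivAlong G φ V x (christoffel g x u v)

/-- The (rough) Laplace operator on vector fields along `φ`, with the sign convention
`Δ = - trace ∇̃²`. -/
def roughLaplacian {m n : ℕ} (g : Coord m → Form m) (G : Coord n → Form n)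
    (φ V : Coord m → Coord n) (x : Coord m) : Coord n :=
  - metricTrace g x (covHessianAlong g G φ V x)

/-- The bitension field `τ₂(φ) = - Δ τ(φ) - trace R̃(dφ, τ(φ)) dφ`. -/
def bitension {m n : ℕ} (g : Coord m → Form m) (G : Coord n → Form n)
    (φ : Coord m → Coord n) (x : Coord m) : Coord n :=
  - roughLaplacian g G φ (tension g G φ) x
    - metricTrace g x (fun u v =>
        curvature G (φ x) (fderiv ℝ φ x u) (tension g G φ x) (fderiv ℝ φ x v))

/-- `ξ` is a unit normal vector at `x` to the immersion `φ`: `⟨ξ, dφ u⟩ = 0` for all `u` and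
`⟨ξ, ξ⟩ = ±1`. -/
def IsUnitNormal {m n : ℕ} (G : Coord n → Form n) (φ : Coord m → Coord n) (x : Coord m)
    (ξ : Coord n) : Prop :=
  (∀ u : Coord m, G (φ x) ξ (fderiv ℝ φ x u) = 0) ∧ (G (φ x) ξ ξ = 1 ∨ G (φ x) ξ ξ = -1)

/-- The shape operator `A` at `x` associated with the normal vector `ξ`, given by
`⟨A u, v⟩ = ⟨B(u, v), ξ⟩`. -/
def shapeOperator {m n : ℕ} (g : Coord m → Form m) (G : Coord n → Form n)
    (φ : Coord m → Coord n) (x : Coord m) (ξ : Coord n) : Coord m →L[ℝ] Coord m :=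
  (g x).inverse.comp
    ((ContinuousLinearMap.compL ℝ (Coord m) (Coord n) ℝ (G (φ x) ξ)).comp
      (secondFundamentalForm g G φ x))

theorem shapeOperator_apply {m n : ℕ} (g : Coord m → Form m) (G : Coord n → Form n)
    (φ : Coord m → Coord n) (x : Coord m) (ξ : Coord n) (u : Coord m) :
    shapeOperator g G φ x ξ u =
      (g x).inverse ((G (φ x) ξ).comp (secondFundamentalForm g G φ x u)) := rfl

/-- The principal curvatures at `x` (with respect to `ξ`): the complex eigenvalues of the shape
operator, i.e. the complex roots of its characteristic polynomial. -/
def principalCurvatures {m n : ℕ} (g : Coord m → Form m) (G : Coord n → Form n)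
    (φ : Coord m → Coord n) (x : Coord m) (ξ : Coord n) : Set ℂ :=
  {z | (((shapeOperator g G φ x ξ : Coord m →ₗ[ℝ] Coord m).charpoly).map
    (algebraMap ℝ ℂ)).IsRoot z}

/-! ### Pseudo-Riemannian manifolds -/

/-- A smooth pseudo-Riemannian metric (of arbitrary signature) on a smooth `n`-manifold: a smooth
field of symmetric nondegenerate bilinear forms on the tangent spaces. -/
structure Metric (n : ℕ) (M : Type*) [TopologicalSpace M] [ChartedSpace (Coord n) M]
    [IsManifold (𝓡 n) ∞ M] where
  /-- The scalar product on each tangent space. -/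
  inner (p : M) : TangentSpace (𝓡 n) p →L[ℝ] TangentSpace (𝓡 n) p →L[ℝ] ℝ
  symm (p : M) (v w : TangentSpace (𝓡 n) p) : inner p v w = inner p w v
  nondegenerate (p : M) (v : TangentSpace (𝓡 n) p) : (∀ w, inner p v w = 0) → v = 0
  contMDiff : ContMDiff (𝓡 n) ((𝓡 n).prod 𝓘(ℝ, Form n)) ∞
    (fun p : M => Bundle.TotalSpace.mk' (Form n)
      (E := fun p : M => TangentSpace (𝓡 n) p →L[ℝ] TangentSpace (𝓡 n) p →L[ℝ] ℝ) p (inner p))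

section Manifold

variable {m n : ℕ}
  {M : Type*} [TopologicalSpace M] [ChartedSpace (Coord m) M] [IsManifold (𝓡 m) ∞ M]
  {N : Type*} [TopologicalSpace N] [ChartedSpace (Coord n) N] [IsManifold (𝓡 n) ∞ N]

/-- The expression of a metric in a chart `e`: `(u, v) ↦ ⟨d(e⁻¹) u, d(e⁻¹) v⟩` at `e⁻¹ y`. -/
def Metric.inChart (g : Metric m M) (e : OpenPartialHomeomorph M (Coord m)) (y : Coord m) :
    Form m :=
  letI : ChartedSpace (Coord m) (Coord m) := chartedSpaceSelf (Coord m)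
  let D : Coord m →L[ℝ] Coord m := mfderiv (𝓡 m) (𝓡 m) e.symm y
  let B : Form m := g.inner (e.symm y)
  B.bilinearComp D D

theorem Metric.inChart_apply (g : Metric m M) (e : OpenPartialHomeomorph M (Coord m))
    (y u v : Coord m) :
    letI : ChartedSpace (Coord m) (Coord m) := chartedSpaceSelf (Coord m)
    g.inChart e y u v = g.inner (e.symm y)
      (mfderiv (𝓡 m) (𝓡 m) e.symm y u) (mfderiv (𝓡 m) (𝓡 m) e.symm y v) := rfl

/-- The expression of a map `f : M → N` in charts `e` of `M` and `e'` of `N`. -/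
def mapInCharts (f : M → N) (e : OpenPartialHomeomorph M (Coord m))
    (e' : OpenPartialHomeomorph N (Coord n)) : Coord m → Coord n :=
  fun x => e' (f (e.symm x))

/-- `N` has constant sectional curvature `c`: in every smooth chart, at every point and for every
nondegenerate plane spanned by `u, v`,
`⟨R(u, v)v, u⟩ = c (⟨u, u⟩⟨v, v⟩ - ⟨u, v⟩²)`. -/
def Metric.HasConstantSectionalCurvature (G : Metric n N) (c : ℝ) : Prop :=
  ∀ e ∈ IsManifold.maximalAtlas (𝓡 n) ∞ N, ∀ y ∈ e.target, ∀ u v : Coord n,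
    G.inChart e y u u * G.inChart e y v v - G.inChart e y u v ^ 2 ≠ 0 →
    G.inChart e y (curvature (G.inChart e) y u v v) u /
      (G.inChart e y u u * G.inChart e y v v - G.inChart e y u v ^ 2) = c

/-- `f` is a smooth isometric immersion of `(M, g)` into `(N, G)`. As `g` is nondegenerate, the
differential of such a map is automatically injective. -/
def IsIsometricImmersion (g : Metric m M) (G : Metric n N) (f : M → N) : Prop :=
  ContMDiff (𝓡 m) (𝓡 n) ∞ f ∧
    ∀ (p : M) (u v : TangentSpace (𝓡 m) p),
      G.inner (f p) (mfderiv (𝓡 m) (𝓡 n) f p u) (mfderiv (𝓡 m) (𝓡 n) f p v) = g.inner p u v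

/-- A statement `P x ĝ Ĝ f̂` about the coordinate expressions `ĝ, Ĝ, f̂` of `g, G, f` holds at
all points of `M`, `x` being the coordinates of the point, in all smooth charts of `M` and `N`
around the point and its image. -/
def InAllCharts (g : Metric m M) (G : Metric n N) (f : M → N)
    (P : Coord m → (Coord m → Form m) → (Coord n → Form n) → (Coord m → Coord n) → Prop) : Prop :=
  ∀ e ∈ IsManifold.maximalAtlas (𝓡 m) ∞ M, ∀ e' ∈ IsManifold.maximalAtlas (𝓡 n) ∞ N,
    ∀ p ∈ e.source, f p ∈ e'.source →
      P (e p) (g.inChart e) (G.inChart e') (mapInCharts f e e')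

/-- `f` is biharmonic: its bitension field vanishes. -/
def IsBiharmonic (g : Metric m M) (G : Metric n N) (f : M → N) : Prop :=
  InAllCharts g G f fun x g' G' φ => bitension g' G' φ x = 0

/-- `f` is minimal: its mean curvature vector field vanishes. -/
def IsMinimal (g : Metric m M) (G : Metric n N) (f : M → N) : Prop :=
  InAllCharts g G f fun x g' G' φ => meanCurvatureVector g' G' φ x = 0

/-- At every point, with respect to any unit normal vector, there are exactly two distinct
principal curvatures, and both are imaginary (that is, not real). -/
def HasTwoImaginaryPrincipalCurvatures (g : Metric m M) (G : Metric n N) (f : M → N) : Prop :=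
  InAllCharts g G f fun x g' G' φ => ∀ ξ : Coord n, IsUnitNormal G' φ x ξ →
    (principalCurvatures g' G' φ x ξ).ncard = 2 ∧
      ∀ z ∈ principalCurvatures g' G' φ x ξ, z.im ≠ 0

end Manifold

end PseudoRiemannian

end

/-! Work by contradiction near a point where the tension field τ is nonzero. A normal vector of a
nondegenerate hypersurface is not null, so κ = ⟨τ,τ⟩ is nonzero nearby, and τ itself serves as an
unnormalised normal field, with shape operator A = A_τ and tr A = κ.

The tangential part of τ₂ = 0, combined with the Codazzi equation, says that A(grad κ) = -(κ/2) grad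
κ. As A has no real eigenvalue, κ is locally constant (`tensionLogDeriv_eq_zero`), and the normal
part becomes tr A² = 4cκ (`endTrace_sq`). The characteristic polynomial of A is ((X - a)² + b²)²
with b ≠ 0, so 4a = κ and a² - b² = cκ. Hence a and b² are locally constant, and Codazzi makes ⟨(∇_u
A)v, w⟩ totally symmetric.

The heart is that the squared length of ∇A vanishes at some point, which for an indefinite metric
asserts less than ∇A = 0 (`IsMetricOn.exists_sum_covEnd_eq_zero`). Write A = a + bJ + n with J² =
-1, n² = 0 and Jn = nJ. Then ∇J anticommutes with J and ∇n with n, so the part of ∇A commuting with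
J comes from ∇n alone and anticommutes with n. In dimension four, if n ≠ 0, self-adjoint operators
of this kind have zero products (`mul_eq_zero_of_anticomm`); if n vanishes near the point, the part
itself is zero. Taking traces and using total symmetry gives Σ tr(∇A ∇A) = 0.

Finally, the contracted Simons identity (`IsMetricOn.simons`) with constant tr A and tr A² and null
∇A gives cκ = -(a² + b²). Compared with cκ = a² - b² this forces a = 0, so κ = 0, a contradiction.
-/

namespace PseudoRiemannian

/-! ### Levi-Civita calculus of a metric on an open set of ℝⁿ -/

/-- `G` is a smooth pseudo-Riemannian metric on the open set `V` of `ℝⁿ`. -/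
structure IsMetricOn {n : ℕ} (G : Coord n → Form n) (V : Set (Coord n)) : Prop where
  isOpen : IsOpen V
  contDiffOn : ContDiffOn ℝ ∞ G V
  symm : ∀ y ∈ V, ∀ v w, G y v w = G y w v
  nondegenerate : ∀ y ∈ V, ∀ v, (∀ w, G y v w = 0) → v = 0

/-- `ContinuousLinearMap.inverse` has its intended meaning only at invertible maps. In finite
dimension nondegeneracy supplies the equivalence, which makes `(G y).inverse` both computable and
smooth in `y`. -/
theorem exists_equiv_of_nondegenerate {n : ℕ} (B : Form n)
    (hB : ∀ v, (∀ w, B v w = 0) → v = 0) :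
    ∃ e : Coord n ≃L[ℝ] (Coord n →L[ℝ] ℝ), (e : Coord n →L[ℝ] Coord n →L[ℝ] ℝ) = B := by
  have hinj : Function.Injective (B : Coord n →ₗ[ℝ] (Coord n →L[ℝ] ℝ)) := by
    rw [injective_iff_map_eq_zero]
    intro v hv
    exact hB v fun w => by
      have := congrArg (fun ℓ : Coord n →L[ℝ] ℝ => ℓ w) hv
      simpa using this
  have hdim : Module.finrank ℝ (Coord n) = Module.finrank ℝ (Coord n →L[ℝ] ℝ) := by
    rw [← (LinearMap.toContinuousLinearMap : (Coord n →ₗ[ℝ] ℝ) ≃ₗ[ℝ] _).finrank_eq]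
    exact (Subspace.dual_finrank_eq (K := ℝ) (V := Coord n)).symm
  refine ⟨(LinearEquiv.ofInjectiveOfFinrankEq _ hinj hdim).toContinuousLinearEquiv, ?_⟩
  ext v w
  rfl

namespace IsMetricOn

variable {n : ℕ} {G : Coord n → Form n} {V : Set (Coord n)}

theorem mono (hG : IsMetricOn G V) {W : Set (Coord n)} (hW : IsOpen W) (h : W ⊆ V) :
    IsMetricOn G W :=
  ⟨hW, hG.contDiffOn.mono h, fun y hy => hG.symm y (h hy), fun y hy => hG.nondegenerate y (h hy)⟩

theorem contDiffAt (hG : IsMetricOn G V) {y : Coord n} (hy : y ∈ V) : ContDiffAt ℝ ∞ G y :=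
  hG.contDiffOn.contDiffAt (hG.isOpen.mem_nhds hy)

theorem differentiableAt (hG : IsMetricOn G V) {y : Coord n} (hy : y ∈ V) :
    DifferentiableAt ℝ G y :=
  (hG.contDiffAt hy).differentiableAt (by simp)

theorem apply_inverse (hG : IsMetricOn G V) {y : Coord n} (hy : y ∈ V) (ℓ : Coord n →L[ℝ] ℝ) :
    G y ((G y).inverse ℓ) = ℓ := by
  obtain ⟨e, he⟩ := exists_equiv_of_nondegenerate (G y) (hG.nondegenerate y hy)
  rw [← he, ContinuousLinearMap.inverse_equiv]
  simp

theorem ext_left (hG : IsMetricOn G V) {y : Coord n} (hy : y ∈ V) {v w : Coord n}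
    (h : ∀ z, G y v z = G y w z) : v = w :=
  sub_eq_zero.1 (hG.nondegenerate y hy _ fun z => by simp [h z])

theorem fderiv_symm (hG : IsMetricOn G V) {y : Coord n} (hy : y ∈ V) (u v w : Coord n) :
    fderiv ℝ G y u v w = fderiv ℝ G y u w v := by
  have hd := (hG.differentiableAt hy).hasFDerivAt
  have h1 : ∀ a b : Coord n, HasFDerivAt (fun z => G z a b) ((fderiv ℝ G y).flip a |>.flip b) y := by
    intro a b
    have := (hd.clm_apply (hasFDerivAt_const a y)).clm_apply (hasFDerivAt_const b y)
    refine this.congr_fderiv ?_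
    ext t; simp
  have h2 : (fun z => G z v w) =ᶠ[nhds y] fun z => G z w v := by
    filter_upwards [hG.isOpen.mem_nhds hy] with z hz using hG.symm z hz v w
  have := ((h1 v w).unique ((h1 w v).congr_of_eventuallyEq h2))
  simpa using congrArg (fun ℓ : Coord n →L[ℝ] ℝ => ℓ u) this

theorem apply_christoffel (hG : IsMetricOn G V) {y : Coord n} (hy : y ∈ V) (u v z : Coord n) :
    G y (christoffel G y u v) z =
      (1 / 2 : ℝ) * (fderiv ℝ G y u v z + fderiv ℝ G y v u z - fderiv ℝ G y z u v) := by
  rw [christoffel_apply, hG.apply_inverse hy, koszul_apply]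

theorem christoffel_symm (hG : IsMetricOn G V) {y : Coord n} (hy : y ∈ V) (u v : Coord n) :
    christoffel G y u v = christoffel G y v u :=
  hG.ext_left hy fun z => by
    rw [hG.apply_christoffel hy, hG.apply_christoffel hy, hG.fderiv_symm hy z u v]; ring

/-- Metric compatibility: when the two Koszul expressions are added, the terms antisymmetric in `u`,
`v` cancel. -/
theorem fderiv_eq (hG : IsMetricOn G V) {y : Coord n} (hy : y ∈ V) (z u v : Coord n) :
    fderiv ℝ G y z u v = G y (christoffel G y z u) v + G y u (christoffel G y z v) := by
  rw [hG.symm y hy u, hG.apply_christoffel hy, hG.apply_christoffel hy, hG.fderiv_symm hy z v u]; ring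

theorem contDiffAt_inverse (hG : IsMetricOn G V) {y : Coord n} (hy : y ∈ V) :
    ContDiffAt ℝ ∞ (fun z => (G z).inverse) y := by
  obtain ⟨e, he⟩ := exists_equiv_of_nondegenerate (G y) (hG.nondegenerate y hy)
  have h := contDiffAt_map_inverse (𝕜 := ℝ) (n := ∞) e
  rw [he] at h
  exact h.comp y (hG.contDiffAt hy)

theorem contDiffAt_christoffel (hG : IsMetricOn G V) {y : Coord n} (hy : y ∈ V) :
    ContDiffAt ℝ ∞ (christoffel G) y := by
  have hD : ContDiffAt ℝ ∞ (fderiv ℝ G) y := (hG.contDiffAt hy).fderiv_right (by simp)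
  have hK : ContDiffAt ℝ ∞ (koszul G) y := by
    have hflip : ContDiffAt ℝ ∞ (fun z => (fderiv ℝ G z).flip) y :=
      ((ContinuousLinearMap.flipₗᵢ ℝ (Coord n) (Coord n)
        (Coord n →L[ℝ] ℝ)).toContinuousLinearEquiv.contDiff.contDiffAt).comp y hD
    have hT : ContDiffAt ℝ ∞ (fun _ : Coord n =>
        ((ContinuousLinearMap.flipₗᵢ ℝ (Coord n) (Coord n) ℝ).toContinuousLinearEquiv :
          (Coord n →L[ℝ] Coord n →L[ℝ] ℝ) →L[ℝ] (Coord n →L[ℝ] Coord n →L[ℝ] ℝ))) y :=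
      contDiffAt_const
    have h := (hD.add hflip).sub (hT.clm_comp hflip)
    exact h.const_smul (1 / 2 : ℝ)
  have hc : ContDiffAt ℝ ∞ (fun y => ContinuousLinearMap.compL ℝ (Coord n) (Coord n →L[ℝ] ℝ) (Coord n) (G y).inverse) y :=
    ((ContinuousLinearMap.compL ℝ (Coord n) (Coord n →L[ℝ] ℝ) (Coord n)).contDiff.contDiffAt).comp y (hG.contDiffAt_inverse hy)
  exact hc.clm_comp hK

theorem differentiableAt_christoffel (hG : IsMetricOn G V) {y : Coord n} (hy : y ∈ V) :
    DifferentiableAt ℝ (christoffel G) y :=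
  (hG.contDiffAt_christoffel hy).differentiableAt (by simp)

/-- The curvature tensor in terms of the derivative of the Christoffel map. -/
theorem curvature_eq (hG : IsMetricOn G V) {y : Coord n} (hy : y ∈ V) (u v w : Coord n) :
    curvature G y u v w = fderiv ℝ (christoffel G) y u v w - fderiv ℝ (christoffel G) y v u w
      + christoffel G y u (christoffel G y v w) - christoffel G y v (christoffel G y u w) := by
  have h : ∀ a b c : Coord n, fderiv ℝ (fun y' => christoffel G y' a b) y c
      = fderiv ℝ (christoffel G) y c a b := by
    intro a b c
    have := ((hG.differentiableAt_christoffel hy).hasFDerivAt.clm_apply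
      (hasFDerivAt_const a y)).clm_apply (hasFDerivAt_const b y)
    rw [this.fderiv]; simp
  simp only [curvature, h]

variable {m : ℕ} {φ X Y : Coord m → Coord n} {x : Coord m}

/-- Metric compatibility of the covariant derivative along a map. -/
theorem fderiv_inner (hG : IsMetricOn G V) (hx : φ x ∈ V) (hφ : DifferentiableAt ℝ φ x)
    (hX : DifferentiableAt ℝ X x) (hY : DifferentiableAt ℝ Y x) (u : Coord m) :
    fderiv ℝ (fun t => G (φ t) (X t) (Y t)) x u
      = G (φ x) (covDerivAlong G φ X x u) (Y x) + G (φ x) (X x) (covDerivAlong G φ Y x u) := by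
  have h := (((hG.differentiableAt hx).hasFDerivAt.comp x hφ.hasFDerivAt).clm_apply
    hX.hasFDerivAt).clm_apply hY.hasFDerivAt
  have h' := h.fderiv
  simp only [Function.comp_apply] at h'
  rw [h']
  simp only [covDerivAlong, add_apply, ContinuousLinearMap.comp_apply,
    ContinuousLinearMap.flip_apply, hG.fderiv_eq hx, map_add]
  ring

theorem fderiv_fderiv_apply {E F : Type*} [NormedAddCommGroup E] [NormedSpace ℝ E]
    [NormedAddCommGroup F] [NormedSpace ℝ F] {f : E → F} {x : E} (hf : ContDiffAt ℝ 2 f x)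
    (v : E) : HasFDerivAt (fun t => fderiv ℝ f t v) ((fderiv ℝ (fderiv ℝ f) x).flip v) x := by
  have h : DifferentiableAt ℝ (fderiv ℝ f) x :=
    (hf.fderiv_right (m := 1) (by norm_num)).differentiableAt (by simp)
  have := h.hasFDerivAt.clm_apply (hasFDerivAt_const v x)
  refine this.congr_fderiv ?_
  ext; simp

theorem fderiv_fderiv_symm {E F : Type*} [NormedAddCommGroup E] [NormedSpace ℝ E]
    [NormedAddCommGroup F] [NormedSpace ℝ F] {f : E → F} {x : E} (hf : ContDiffAt ℝ 2 f x)
    (u v : E) : fderiv ℝ (fderiv ℝ f) x u v = fderiv ℝ (fderiv ℝ f) x v u :=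
  (hf.isSymmSndFDerivAt (by simp)).eq u v

/-- The Ricci identity: covariant derivatives of a vector field along a map commute up to
curvature. -/
theorem covDerivAlong_comm (hG : IsMetricOn G V) (hx : φ x ∈ V) (hφ : ContDiffAt ℝ 2 φ x)
    (hX : ContDiffAt ℝ 2 X x) (u v : Coord m) :
    covDerivAlong G φ (fun t => covDerivAlong G φ X t v) x u
      - covDerivAlong G φ (fun t => covDerivAlong G φ X t u) x v
      = curvature G (φ x) (fderiv ℝ φ x u) (fderiv ℝ φ x v) (X x) := by
  -- In this expansion the second derivatives of `X` and `φ` are symmetric in `u, v`, and so is the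
  -- sum of the two terms with a first derivative of `X`. What survives antisymmetrisation is the
  -- derivative of Γ and ΓΓ, that is, the curvature.
  have key : ∀ u v, covDerivAlong G φ (fun t => covDerivAlong G φ X t v) x u
      = fderiv ℝ (fderiv ℝ X) x u v
        + (fderiv ℝ (christoffel G) (φ x) (fderiv ℝ φ x u) (fderiv ℝ φ x v) (X x)
          + christoffel G (φ x) (fderiv ℝ (fderiv ℝ φ) x u v) (X x)
          + christoffel G (φ x) (fderiv ℝ φ x v) (fderiv ℝ X x u))
        + (christoffel G (φ x) (fderiv ℝ φ x u) (fderiv ℝ X x v)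
          + christoffel G (φ x) (fderiv ℝ φ x u) (christoffel G (φ x) (fderiv ℝ φ x v) (X x))) := by
    intro u v
    have h := (((hG.differentiableAt_christoffel hx).hasFDerivAt.comp x
      (hφ.differentiableAt (by simp)).hasFDerivAt).clm_apply
      (fderiv_fderiv_apply hφ v)).clm_apply (hX.differentiableAt (by simp)).hasFDerivAt
    have h2 := ((fderiv_fderiv_apply hX v).add h).fderiv
    simp only [Function.comp_apply] at h2
    have h3 : fderiv ℝ (fun t => covDerivAlong G φ X t v) x = _ := h2
    rw [covDerivAlong, h3]
    simp only [covDerivAlong, add_apply, ContinuousLinearMap.comp_apply,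
    ContinuousLinearMap.flip_apply, map_add]
    abel
  rw [key u v, key v u, hG.curvature_eq hx, fderiv_fderiv_symm hX v u, fderiv_fderiv_symm hφ v u]
  abel

end IsMetricOn

/-! ### Constant sectional curvature determines the curvature tensor -/

theorem two_le_infty : (2 : WithTop ℕ∞) ≤ ∞ := by
  exact WithTop.coe_le_coe.2 (le_top : (2 : ℕ∞) ≤ ⊤)

/-- If a quadratic polynomial vanishes wherever a second one with nonzero leading coefficient does
not, then it vanishes identically. -/
theorem eq_zero_of_quadratic {α β γ α' β' γ' : ℝ} (hγ' : γ' ≠ 0)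
    (h : ∀ t : ℝ, α' + β' * t + γ' * t ^ 2 ≠ 0 → α + β * t + γ * t ^ 2 = 0) : α = 0 := by
  open Polynomial in
  have hpq : (C α + C β * X + C γ * X ^ 2) * (C α' + C β' * X + C γ' * X ^ 2) = (0 : ℝ[X]) := by
    refine Polynomial.funext fun t => ?_
    by_cases ht : α' + β' * t + γ' * t ^ 2 = 0
    · simp [ht]
    · simp [h t ht]
  rcases mul_eq_zero.1 hpq with h0 | h0
  · simpa using congrArg (fun p => Polynomial.coeff p 0) h0
  · have h2 := congrArg (fun p => Polynomial.coeff p 2) h0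
    exact absurd (by simpa [Polynomial.coeff_X, Polynomial.coeff_C] using h2) hγ'

/-- An algebraic curvature tensor is determined by its sectional curvatures. -/
theorem curvatureLike_eq_zero {E : Type*} [AddCommGroup E] [Module ℝ E]
    (T : E → E →ₗ[ℝ] E →ₗ[ℝ] E →ₗ[ℝ] ℝ) (h12 : ∀ u v w z, T u v w z = -T v u w z)
    (h34 : ∀ u v w z, T u v w z = -T u v z w)
    (hB : ∀ u v w z, T u v w z + T v w u z + T w u v z = 0)
    (hK : ∀ u v, T u v v u = 0) (u v w z : E) : T u v w z = 0 := by
  -- Pair symmetry, from the four Bianchi identities on the cyclic shifts of the arguments.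
  have hp : ∀ u v w z, T u v w z = T w z u v := by
    intro u v w z
    have e1 := hB u v w z
    have e2 := hB v w z u
    have e3 := hB w z u v
    have e4 := hB z u v w
    have := h34 u v w z
    have := h34 v w u z
    have := h34 w u v z
    have := h34 v w z u
    have := h34 w z v u
    have := h34 w z u v
    have := h34 u w z v
    have := h34 z u w v
    have := h34 u v z w
    have := h34 v z u w
    have := h34 z v w u
    have := h12 w u v z
    have := h12 u w z v
    have := h12 v z u w
    have := h12 z v w u
    have := h34 w u z v
    linarith
  have hadd1 : ∀ a b v w z, T (a + b) v w z = T a v w z + T b v w z := by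
    intro a b v w z
    rw [h12, map_add, LinearMap.add_apply, LinearMap.add_apply, h12 a, h12 b]; ring
  -- Polarising `hK` makes this expression antisymmetric in `v`, `w`, while pair symmetry makes it
  -- symmetric. Polarising once more in `p2` gives antisymmetry in the outer slots, so `T` is
  -- totally antisymmetric and the Bianchi sum equals `3 T`.
  have p1 : ∀ u v w, T u v w u = 0 := by
    intro u v w
    have e := hK u (v + w)
    simp only [map_add, LinearMap.add_apply, hK] at e
    have e1 := hp u w v u
    have e2 := h12 v u u w
    have e3 := h34 u v u w
    linarith
  have p2 : ∀ u v w z, T u v w z = -T z v w u := by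
    intro u v w z
    have e := p1 (u + z) v w
    rw [hadd1] at e
    simp only [map_add, p1] at e
    linarith
  have e := hB u v w z
  have a1 := p2 v w u z
  have a2 := hp z w u v
  have a3 := p2 w u v z
  have a4 := h12 z u v w
  have a5 := p2 u v w z
  have a6 := h34 v w u z
  have a7 := p2 u v z w
  have a8 := h34 w v z u
  have a9 := h12 w v u z
  have b1 := h34 u v w z
  have b2 := hp w v z u
  have b3 := h34 u w z v
  have b4 := p2 u w z v
  have b5 := h12 w u z v
  have b6 := h34 w u v z
  have b7 := p2 u w v z
  have b8 := h12 z w v u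
  have b9 := h34 w z v u
  have c1 := h12 w z u v
  linarith

variable {n : ℕ} {G : Coord n → Form n} {V : Set (Coord n)}

namespace IsMetricOn

/-- The connection is torsion-free: the Christoffel map and its derivative are symmetric in the two
vector arguments, so the cyclic sum cancels. -/
theorem curvature_bianchi (hG : IsMetricOn G V) {y : Coord n} (hy : y ∈ V) (u v w : Coord n) :
    curvature G y u v w + curvature G y v w u + curvature G y w u v = 0 := by
  have hs : ∀ a b c, fderiv ℝ (christoffel G) y a b c = fderiv ℝ (christoffel G) y a c b := by
    intro a b c
    have hd := (hG.differentiableAt_christoffel hy).hasFDerivAt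
    have h1 : ∀ b c : Coord n, HasFDerivAt (fun z => christoffel G z b c)
        ((fderiv ℝ (christoffel G) y).flip b |>.flip c) y := by
      intro b c
      have := (hd.clm_apply (hasFDerivAt_const b y)).clm_apply (hasFDerivAt_const c y)
      refine this.congr_fderiv ?_
      ext t; simp
    have h2 : (fun z => christoffel G z b c) =ᶠ[nhds y] fun z => christoffel G z c b := by
      filter_upwards [hG.isOpen.mem_nhds hy] with z hz using hG.christoffel_symm hz b c
    have := (h1 b c).unique ((h1 c b).congr_of_eventuallyEq h2)
    simpa using congrArg (fun ℓ : Coord n →L[ℝ] Coord n => ℓ a) this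
  simp only [hG.curvature_eq hy]
  rw [hs u v w, hs v w u, hs w u v, hG.christoffel_symm hy v w, hG.christoffel_symm hy u w,
    hG.christoffel_symm hy v u]
  abel

/-- The second derivatives of the function ⟨w, z⟩, for constant `w`, `z`, commute. Expanding them by
metric compatibility, the products of first covariant derivatives are symmetric in `u`, `v`, and
what remains is ⟨R(u,v)w, z⟩ + ⟨w, R(u,v)z⟩ = 0. -/
theorem inner_curvature_antisymm (hG : IsMetricOn G V) {y : Coord n} (hy : y ∈ V)
    (u v w z : Coord n) :
    G y (curvature G y u v w) z = -G y (curvature G y u v z) w := by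
  have hid : ∀ a : Coord n, fderiv ℝ (id : Coord n → Coord n) a = ContinuousLinearMap.id ℝ _ :=
    fun a => fderiv_id
  -- `K a b` is ∇_b a for the constant field `a`: intrinsic covariant derivatives are those along
  -- the identity map.
  set K : Coord n → Coord n → Coord n → Coord n :=
    fun a b t => covDerivAlong G id (fun _ => a) t b with hK
  have hKe : ∀ a b t, K a b t = christoffel G t b a := by
    intro a b t; simp [hK, covDerivAlong]
  have hKd : ∀ a b, DifferentiableAt ℝ (K a b) y := by
    intro a b
    have : K a b = fun t => christoffel G t b a := funext (hKe a b)
    rw [this]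
    exact ((hG.differentiableAt_christoffel hy).clm_apply (differentiableAt_const b)).clm_apply
      (differentiableAt_const a)
  have hC : ContDiffAt ℝ 2 (fun t => G t w z) y :=
    (((hG.contDiffAt hy).clm_apply contDiffAt_const).clm_apply contDiffAt_const).of_le two_le_infty
  have h1 : ∀ b, (fun t => fderiv ℝ (fun s => G s w z) t b) =ᶠ[nhds y]
      fun t => G t (K w b t) z + G t w (K z b t) := by
    intro b
    filter_upwards [hG.isOpen.mem_nhds hy] with t ht
    exact hG.fderiv_inner (φ := id) (X := fun _ => w) (Y := fun _ => z) (x := t) ht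
      differentiableAt_id (differentiableAt_const _) (differentiableAt_const _) b
  have hdd : ∀ a b, DifferentiableAt ℝ (fun t => G t (K a b t) z) y ∧
      DifferentiableAt ℝ (fun t => G t w (K a b t)) y := fun a b =>
    ⟨((hG.differentiableAt hy).clm_apply (hKd a b)).clm_apply (differentiableAt_const _),
      ((hG.differentiableAt hy).clm_apply (differentiableAt_const _)).clm_apply (hKd a b)⟩
  have h2 : ∀ a b, fderiv ℝ (fderiv ℝ (fun s => G s w z)) y a b =
      G y (covDerivAlong G id (K w b) y a) z + G y (K w b y) (K z a y)
      + (G y (K w a y) (K z b y) + G y w (covDerivAlong G id (K z b) y a)) := by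
    intro a b
    have e1 : fderiv ℝ (fun t => fderiv ℝ (fun s => G s w z) t b) y
        = (fderiv ℝ (fderiv ℝ (fun s => G s w z)) y).flip b := (fderiv_fderiv_apply hC b).fderiv
    have e2 := (h1 b).fderiv_eq (𝕜 := ℝ)
    rw [e1] at e2
    have e3 := congrArg (fun ℓ : Coord n →L[ℝ] ℝ => ℓ a) e2
    simp only [ContinuousLinearMap.flip_apply] at e3
    rw [e3, fderiv_fun_add (hdd w b).1 (hdd z b).2, add_apply]
    exact congrArg₂ (· + ·) (hG.fderiv_inner (φ := id) (X := K w b) (Y := fun _ => z) hy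
      differentiableAt_id (hKd _ _) (differentiableAt_const _) a)
      (hG.fderiv_inner (φ := id) (X := fun _ => w) (Y := K z b) hy
      differentiableAt_id (differentiableAt_const _) (hKd _ _) a)
  have h3 := fderiv_fderiv_symm hC u v
  rw [h2, h2] at h3
  have hR : ∀ a, curvature G y u v a = covDerivAlong G id (K a v) y u
      - covDerivAlong G id (K a u) y v := by
    intro a
    have := hG.covDerivAlong_comm (φ := id) (X := fun _ => a) (x := y) hy contDiffAt_id
      contDiffAt_const u v
    rw [hid] at this
    exact this.symm
  rw [hR w, hR z, map_sub, hG.symm y hy _ w, map_sub, sub_apply]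
  linarith

theorem curvature_antisymm (G : Coord n → Form n) (y u v w : Coord n) :
    curvature G y u v w = -curvature G y v u w := by
  simp only [curvature]; abel

/-- The curvature of a metric of constant sectional curvature `c`. -/
theorem curvature_eq_of_const (hG : IsMetricOn G V) (hn : 2 ≤ n) {c : ℝ} {y : Coord n} (hy : y ∈ V)
    (hc : ∀ u v, G y u u * G y v v - G y u v ^ 2 ≠ 0 →
      G y (curvature G y u v v) u / (G y u u * G y v v - G y u v ^ 2) = c) (u v w : Coord n) :
    curvature G y u v w = c • (G y v w • u - G y u w • v) := by
  have hs := hG.symm y hy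
  -- the difference of both sides as a multilinear map
  let R : Coord n → Coord n →ₗ[ℝ] Coord n →ₗ[ℝ] Coord n →ₗ[ℝ] ℝ := fun u =>
    LinearMap.mk₂ ℝ (fun v w => ((G y (curvature G y u v w - c • (G y v w • u - G y u w • v)) :
      Coord n →L[ℝ] ℝ) : Coord n →ₗ[ℝ] ℝ))
      (fun v v' w => by
        ext z; simp only [hG.curvature_eq hy]; simp; ring)
      (fun a v w => by
        ext z; simp only [hG.curvature_eq hy]; simp; ring)
      (fun v w w' => by
        ext z; simp only [hG.curvature_eq hy]; simp; ring)
      (fun a v w => by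
        ext z; simp only [hG.curvature_eq hy]; simp; ring)
  have hR : ∀ u v w z, R u v w z = G y (curvature G y u v w) z
      - c * (G y v w * G y u z - G y u w * G y v z) := by
    intro u v w z
    simp [R]
  have h12 : ∀ u v w z, R u v w z = -R v u w z := by
    intro u v w z
    rw [hR, hR, curvature_antisymm, map_neg, neg_apply]; ring
  have h34 : ∀ u v w z, R u v w z = -R u v z w := by
    intro u v w z
    rw [hR, hR, hG.inner_curvature_antisymm hy]; ring
  have hB : ∀ u v w z, R u v w z + R v w u z + R w u v z = 0 := by
    intro u v w z
    have := congrArg (fun a => G y a z) (hG.curvature_bianchi hy u v w)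
    simp only [map_add, add_apply, map_zero, zero_apply] at this
    rw [hR, hR, hR, hs v u, hs w u, hs w v]
    linarith
  have hadd : ∀ a b v w z, R (a + b) v w z = R a v w z + R b v w z := by
    intro a b v w z
    rw [h12, map_add, LinearMap.add_apply, LinearMap.add_apply, h12 a, h12 b]; ring
  have hsmul : ∀ (t : ℝ) b v w z, R (t • b) v w z = t * R b v w z := by
    intro t b v w z
    rw [h12, map_smul, LinearMap.smul_apply, LinearMap.smul_apply, h12 b, smul_eq_mul]; ring
  have k0 : ∀ u v, G y u u * G y v v - G y u v ^ 2 ≠ 0 → R u v v u = 0 := by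
    intro u v h
    have := hc u v h
    rw [div_eq_iff h] at this
    rw [hR, this, hs v u]; ring
  -- a plane containing a given non-null vector
  have hplane : ∀ u, G y u u ≠ 0 → ∃ w, G y u u * G y w w - G y u w ^ 2 ≠ 0 := by
    intro u hu
    by_contra! hcon
    -- If every plane through `u` were degenerate, polarisation would give this product formula. In
    -- dimension at least two the kernel of ⟨u, ·⟩ contains some `w ≠ 0`, and the formula makes it
    -- orthogonal to everything.
    have hpol : ∀ w z, G y u u * G y w z = G y u w * G y u z := by
      intro w z
      have e1 := hcon (w + z)
      have e2 := hcon w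
      have e3 := hcon z
      simp only [map_add, add_apply, hs z w] at e1
      linarith
    obtain ⟨w, hw, hw0⟩ : ∃ w ∈ LinearMap.ker (G y u : Coord n →ₗ[ℝ] ℝ), w ≠ 0 := by
      apply Submodule.exists_mem_ne_zero_of_ne_bot
      intro hbot
      have h1 := LinearMap.finrank_range_add_finrank_ker (G y u : Coord n →ₗ[ℝ] ℝ)
      have h2 := Submodule.finrank_le (LinearMap.range (G y u : Coord n →ₗ[ℝ] ℝ))
      rw [hbot, finrank_bot, finrank_euclideanSpace_fin] at h1
      rw [Module.finrank_self] at h2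
      omega
    refine hw0 (hG.nondegenerate y hy w fun z => ?_)
    have hw' : G y u w = 0 := hw
    have := hpol w z
    rw [hw', zero_mul] at this
    exact (mul_eq_zero.1 this).resolve_left hu
  -- The hypothesis says nothing about degenerate planes. Along `v + t w` the Gram determinant is a
  -- quadratic in `t` with nonzero leading coefficient, so the quadratic `R u (v + t w) (v + t w) u`
  -- vanishes identically, in particular at `t = 0`.
  have k1 : ∀ u v, G y u u ≠ 0 → R u v v u = 0 := by
    intro u v hu
    obtain ⟨w, hw⟩ := hplane u hu
    refine eq_zero_of_quadratic (β := R u v w u + R u w v u) (γ := R u w w u)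
      (α' := G y u u * G y v v - G y u v ^ 2)
      (β' := 2 * (G y u u * G y v w - G y u v * G y u w)) hw fun t ht => ?_
    have := k0 u (v + t • w) (by
      simp only [map_add, map_smul, add_apply, smul_apply, smul_eq_mul, hs w v]
      convert ht using 1; ring)
    simp only [map_add, map_smul, LinearMap.add_apply, LinearMap.smul_apply, smul_eq_mul] at this
    linarith
  obtain ⟨u₀, hu₀⟩ : ∃ u₀, G y u₀ u₀ ≠ 0 := by
    by_contra! hcon
    have hpol : ∀ w z, G y w z = 0 := by
      intro w z
      have e1 := hcon (w + z)
      simp only [map_add, add_apply, hs z w, hcon w, hcon z] at e1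
      linarith
    have : Nontrivial (Coord n) := by
      have : NeZero n := ⟨by omega⟩
      infer_instance
    obtain ⟨w, hw⟩ := exists_ne (0 : Coord n)
    exact hw (hG.nondegenerate y hy w (hpol w))
  -- The same density argument removes the assumption that `u` is not null, moving `u` along a fixed
  -- non-null `u₀`.
  have k2 : ∀ u v, R u v v u = 0 := by
    intro u v
    refine eq_zero_of_quadratic (β := R u v v u₀ + R u₀ v v u) (γ := R u₀ v v u₀)
      (α' := G y u u) (β' := 2 * G y u u₀) hu₀ fun t ht => ?_
    have := k1 (u + t • u₀) v (by
      simp only [map_add, map_smul, add_apply, smul_apply, smul_eq_mul, hs u₀ u]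
      convert ht using 1; ring)
    simp only [hadd, hsmul] at this
    simp only [map_add, map_smul, smul_eq_mul] at this
    linarith
  refine sub_eq_zero.1 (hG.nondegenerate y hy _ fun z => ?_)
  exact curvatureLike_eq_zero R h12 h34 hB k2 u v w z

end IsMetricOn

/-! ### Traces in terms of a basis and its metric dual -/

/-- The trace of a continuous endomorphism of `ℝⁿ`. -/
noncomputable def endTrace (n : ℕ) : (Coord n →L[ℝ] Coord n) →L[ℝ] ℝ :=
  LinearMap.toContinuousLinearMap
    ((LinearMap.trace ℝ (Coord n)).comp (ContinuousLinearMap.coeLM ℝ))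

theorem endTrace_apply {n : ℕ} (T : Coord n →L[ℝ] Coord n) :
    endTrace n T = LinearMap.trace ℝ (Coord n) (T : Coord n →ₗ[ℝ] Coord n) := rfl

theorem endTrace_comp_comm {n : ℕ} (S T : Coord n →L[ℝ] Coord n) :
    endTrace n (S.comp T) = endTrace n (T.comp S) :=
  LinearMap.trace_mul_comm ℝ (S : Coord n →ₗ[ℝ] Coord n) (T : Coord n →ₗ[ℝ] Coord n)

/-- The `i`-th standard basis vector. -/
noncomputable abbrev stdVec {n : ℕ} (i : Fin n) : Coord n := EuclideanSpace.single i (1 : ℝ)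

/-- The vector dual to the `i`-th standard basis vector with respect to a bilinear form. -/
noncomputable def dualVec {n : ℕ} (B : Form n) (i : Fin n) : Coord n :=
  B.inverse (EuclideanSpace.proj i)

theorem sum_smul_stdVec {n : ℕ} (v : Coord n) : ∑ i, v i • (stdVec i : Coord n) = v := by
  ext j; simp [stdVec, Finset.sum_apply, Pi.single_apply]

theorem metricTrace_eq {m n : ℕ} (g : Coord m → Form m) (x : Coord m)
    (B : Coord m → Coord m → Coord n) :
    metricTrace g x B = ∑ i, B (dualVec (g x) i) (stdVec i) := rfl

namespace IsMetricOn

variable {n : ℕ} {G : Coord n → Form n} {V : Set (Coord n)} {y : Coord n}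

theorem dualVec_apply (hG : IsMetricOn G V) (hy : y ∈ V) (i : Fin n) (v : Coord n) :
    G y (dualVec (G y) i) v = v i := by
  rw [dualVec, hG.apply_inverse hy]; rfl

/-- Resolution of the identity by the dual pair of bases; it performs the index contractions in the
trace computations. -/
theorem sum_dualVec_stdVec (hG : IsMetricOn G V) (hy : y ∈ V) (u v : Coord n) :
    ∑ i, G y u (dualVec (G y) i) * G y (stdVec i) v = G y u v := by
  conv_rhs => rw [← sum_smul_stdVec u]
  simp only [map_sum, map_smul, sum_apply, smul_apply, smul_eq_mul]
  refine Finset.sum_congr rfl fun i _ => ?_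
  rw [hG.symm y hy u, hG.dualVec_apply hy]

theorem sum_stdVec_dualVec (hG : IsMetricOn G V) (hy : y ∈ V) (u v : Coord n) :
    ∑ i, G y u (stdVec i) * G y (dualVec (G y) i) v = G y u v := by
  rw [hG.symm y hy u v, ← hG.sum_dualVec_stdVec hy v u]
  refine Finset.sum_congr rfl fun i _ => ?_
  rw [hG.symm y hy u, hG.symm y hy _ v, mul_comm]

theorem endTrace_eq (hG : IsMetricOn G V) (hy : y ∈ V) (T : Coord n →L[ℝ] Coord n) :
    endTrace n T = ∑ i, G y (dualVec (G y) i) (T (stdVec i)) := by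
  rw [endTrace_apply, LinearMap.trace_eq_sum_inner _ (EuclideanSpace.basisFun (Fin n) ℝ)]
  refine Finset.sum_congr rfl fun i _ => ?_
  rw [hG.dualVec_apply hy]
  simp [stdVec, EuclideanSpace.inner_single_left]

/-- Here `T` acts on the dual vector. Since `T` need not be self-adjoint, this is obtained by
expanding the dual vectors in the standard basis rather than by moving `T` across. -/
theorem endTrace_eq' (hG : IsMetricOn G V) (hy : y ∈ V) (T : Coord n →L[ℝ] Coord n) :
    endTrace n T = ∑ i, G y (T (dualVec (G y) i)) (stdVec i) := by
  have h1 : ∀ i, G y (T (dualVec (G y) i)) (stdVec i)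
      = ∑ j, G y (T (stdVec j)) (stdVec i) * G y (dualVec (G y) j) (dualVec (G y) i) := by
    intro i
    conv_lhs => rw [← sum_smul_stdVec (dualVec (G y) i)]
    simp only [map_sum, map_smul, sum_apply, smul_apply, smul_eq_mul]
    refine Finset.sum_congr rfl fun j _ => ?_
    rw [hG.dualVec_apply hy j, mul_comm]
  simp only [h1]
  rw [Finset.sum_comm, hG.endTrace_eq hy]
  refine Finset.sum_congr rfl fun j _ => ?_
  rw [hG.symm y hy _ (T _), ← hG.sum_stdVec_dualVec hy]
  exact Finset.sum_congr rfl fun i _ => by rw [hG.symm y hy (dualVec (G y) j)]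

end IsMetricOn

/-! ### Hypersurfaces in coordinates: Gauss and Weingarten formulas for the normal field τ -/

/-- `φ` is a smooth isometric immersion, as a hypersurface, of an open piece `(U, g)` of `ℝᵐ`
into an open piece `(V, G)` of `ℝᵐ⁺¹`, the ambient metric having constant curvature `c`. -/
structure IsHypersurfaceOn {m : ℕ} (g : Coord m → Form m) (G : Coord (m + 1) → Form (m + 1))
    (φ : Coord m → Coord (m + 1)) (U : Set (Coord m)) (V : Set (Coord (m + 1))) (c : ℝ) :
    Prop where
  left : IsMetricOn g U
  right : IsMetricOn G V
  contDiffOn : ContDiffOn ℝ ∞ φ U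
  mapsTo : ∀ x ∈ U, φ x ∈ V
  isometry : ∀ x ∈ U, ∀ u v, G (φ x) (fderiv ℝ φ x u) (fderiv ℝ φ x v) = g x u v
  curvature_eq : ∀ y ∈ V, ∀ u v w, curvature G y u v w = c • (G y v w • u - G y u w • v)

/-- The shape operator with respect to the tension field. -/
noncomputable def tensionShape {m n : ℕ} (g : Coord m → Form m) (G : Coord n → Form n)
    (φ : Coord m → Coord n) (x : Coord m) : Coord m →L[ℝ] Coord m :=
  shapeOperator g G φ x (tension g G φ x)

/-- The squared length of the tension field. -/
noncomputable def tensionSq {m n : ℕ} (g : Coord m → Form m) (G : Coord n → Form n)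
    (φ : Coord m → Coord n) (x : Coord m) : ℝ :=
  G (φ x) (tension g G φ x) (tension g G φ x)

/-- The covariant derivative of a field of endomorphisms. -/
noncomputable def covEnd {m : ℕ} (g : Coord m → Form m) (T : Coord m → Coord m →L[ℝ] Coord m)
    (x u : Coord m) : Coord m →L[ℝ] Coord m :=
  fderiv ℝ T x u + (christoffel g x u).comp (T x) - (T x).comp (christoffel g x u)

/-- The Christoffel terms form a commutator, which has trace zero. -/
theorem endTrace_covEnd {m : ℕ} {g : Coord m → Form m} {T : Coord m → Coord m →L[ℝ] Coord m}
    {x : Coord m} (hT : DifferentiableAt ℝ T x) (u : Coord m) :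
    endTrace m (covEnd g T x u) = fderiv ℝ (fun t => endTrace m (T t)) x u := by
  have h := ((endTrace m).hasFDerivAt.comp x hT.hasFDerivAt).fderiv
  have h' : fderiv ℝ (fun t => endTrace m (T t)) x = (endTrace m).comp (fderiv ℝ T x) := h
  rw [h', covEnd, map_sub, map_add, endTrace_comp_comm (T x)]
  simp

/-- `∇_u (T v) = (∇_u T) v + T (∇_u v)` for constant `v`. -/
theorem covDerivAlong_end_apply {m : ℕ} {g : Coord m → Form m}
    {T : Coord m → Coord m →L[ℝ] Coord m} {x : Coord m} (hT : DifferentiableAt ℝ T x)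
    (u v : Coord m) : covDerivAlong g id (fun t => T t v) x u
      = covEnd g T x u v + T x (christoffel g x u v) := by
  have h := (hT.hasFDerivAt.clm_apply (hasFDerivAt_const v x)).fderiv
  simp only [covDerivAlong, h, covEnd]
  simp

/-- The covariant derivative of a self-adjoint field is self-adjoint. -/
theorem IsMetricOn.covEnd_symm {m : ℕ} {g : Coord m → Form m} {U : Set (Coord m)}
    (hg : IsMetricOn g U) {T : Coord m → Coord m →L[ℝ] Coord m} {x : Coord m} (hx : x ∈ U)
    (hT : DifferentiableAt ℝ T x) (hs : ∀ t ∈ U, ∀ v w, g t (T t v) w = g t v (T t w))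
    (u v w : Coord m) : g x (covEnd g T x u v) w = g x v (covEnd g T x u w) := by
  have hTv : ∀ v, DifferentiableAt ℝ (fun t => T t v) x := fun v =>
    hT.clm_apply (differentiableAt_const v)
  have h1 := hg.fderiv_inner (φ := id) (X := fun t => T t v) (Y := fun _ => w) (x := x) hx
    differentiableAt_id (hTv v) (differentiableAt_const _) u
  have h2 := hg.fderiv_inner (φ := id) (X := fun _ => v) (Y := fun t => T t w) (x := x) hx
    differentiableAt_id (differentiableAt_const _) (hTv w) u
  have h3 : (fun t => g (id t) (T t v) w) =ᶠ[nhds x] fun t => g (id t) v (T t w) := by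
    filter_upwards [hg.isOpen.mem_nhds hx] with t ht using hs t ht v w
  rw [h3.fderiv_eq (𝕜 := ℝ), h2, covDerivAlong_end_apply hT, covDerivAlong_end_apply hT] at h1
  have hc : ∀ a : Coord m, covDerivAlong g id (fun _ => a) x u = christoffel g x u a := by
    intro a; simp [covDerivAlong]
  have e1 := hs x hx v (christoffel g x u w)
  have e2 := hs x hx (christoffel g x u v) w
  simp only [hc, id, map_add, add_apply] at h1
  linarith

theorem covDerivAlong_congr {m n : ℕ} {G : Coord n → Form n} {φ X Y : Coord m → Coord n}
    {x : Coord m} (h : X =ᶠ[nhds x] Y) (u : Coord m) :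
    covDerivAlong G φ X x u = covDerivAlong G φ Y x u := by
  rw [covDerivAlong, covDerivAlong, h.fderiv_eq, h.eq_of_nhds]

theorem covDerivAlong_add {m n : ℕ} {G : Coord n → Form n} {φ X Y : Coord m → Coord n}
    {x : Coord m} (hX : DifferentiableAt ℝ X x) (hY : DifferentiableAt ℝ Y x) (u : Coord m) :
    covDerivAlong G φ (fun t => X t + Y t) x u
      = covDerivAlong G φ X x u + covDerivAlong G φ Y x u := by
  simp only [covDerivAlong, fderiv_fun_add hX hY, map_add, add_apply]
  abel

theorem covDerivAlong_smul {m n : ℕ} {G : Coord n → Form n} {φ X : Coord m → Coord n}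
    {s : Coord m → ℝ} {x : Coord m} (hs : DifferentiableAt ℝ s x) (hX : DifferentiableAt ℝ X x)
    (u : Coord m) : covDerivAlong G φ (fun t => s t • X t) x u
      = fderiv ℝ s x u • X x + s x • covDerivAlong G φ X x u := by
  simp only [covDerivAlong, fderiv_fun_smul hs hX, map_smul, add_apply, smul_apply,
    ContinuousLinearMap.smulRight_apply, smul_add]
  abel

namespace IsHypersurfaceOn

variable {m : ℕ} {g : Coord m → Form m} {G : Coord (m + 1) → Form (m + 1)}
  {φ : Coord m → Coord (m + 1)} {U : Set (Coord m)} {V : Set (Coord (m + 1))} {c : ℝ}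
  {x : Coord m}

theorem mono (h : IsHypersurfaceOn g G φ U V c) {W : Set (Coord m)} (hW : IsOpen W)
    (hWU : W ⊆ U) : IsHypersurfaceOn g G φ W V c :=
  ⟨h.left.mono hW hWU, h.right, h.contDiffOn.mono hWU, fun x hx => h.mapsTo x (hWU hx),
    fun x hx => h.isometry x (hWU hx), h.curvature_eq⟩

theorem contDiffAt (h : IsHypersurfaceOn g G φ U V c) (hx : x ∈ U) : ContDiffAt ℝ ∞ φ x :=
  h.contDiffOn.contDiffAt (h.left.isOpen.mem_nhds hx)

theorem contDiffAt_fderiv (h : IsHypersurfaceOn g G φ U V c) (hx : x ∈ U) :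
    ContDiffAt ℝ ∞ (fderiv ℝ φ) x :=
  (h.contDiffAt hx).fderiv_right (by simp)

theorem contDiffAt_secondFundamentalForm (h : IsHypersurfaceOn g G φ U V c) (hx : x ∈ U) :
    ContDiffAt ℝ ∞ (secondFundamentalForm g G φ) x := by
  have h2 : ContDiffAt ℝ ∞ (fderiv ℝ (fderiv ℝ φ)) x :=
    (h.contDiffAt_fderiv hx).fderiv_right (by simp)
  have hΓ : ContDiffAt ℝ ∞ (fun t => christoffel G (φ t)) x :=
    (h.right.contDiffAt_christoffel (h.mapsTo x hx)).comp x (h.contDiffAt hx)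
  have hD := h.contDiffAt_fderiv hx
  have hflip : ∀ {E F : Type} [NormedAddCommGroup E] [NormedSpace ℝ E] [NormedAddCommGroup F]
      [NormedSpace ℝ F] {f : Coord m → E →L[ℝ] F →L[ℝ] Coord (m + 1)},
      ContDiffAt ℝ ∞ f x → ContDiffAt ℝ ∞ (fun t => (f t).flip) x := by
    intro E F _ _ _ _ f hf
    exact ((ContinuousLinearMap.flipₗᵢ ℝ E F
      (Coord (m + 1))).toContinuousLinearEquiv.contDiff.contDiffAt).comp x hf
  -- A bilinear composition is a composition in the first slot, a flip, a second composition and a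
  -- flip back.
  have hb : ContDiffAt ℝ ∞ (fun t => (christoffel G (φ t)).bilinearComp (fderiv ℝ φ t)
      (fderiv ℝ φ t)) x := hflip ((hflip (hΓ.clm_comp hD)).clm_comp hD)
  have hc : ContDiffAt ℝ ∞ (fun t => ContinuousLinearMap.compL ℝ (Coord m) (Coord m)
      (Coord (m + 1)) (fderiv ℝ φ t)) x :=
    ((ContinuousLinearMap.compL ℝ (Coord m) (Coord m)
      (Coord (m + 1))).contDiff.contDiffAt).comp x hD
  exact (h2.add hb).sub (hc.clm_comp (h.left.contDiffAt_christoffel hx))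

theorem contDiffAt_tension (h : IsHypersurfaceOn g G φ U V c) (hx : x ∈ U) :
    ContDiffAt ℝ ∞ (tension g G φ) x := by
  unfold tension metricTrace
  refine ContDiffAt.sum fun i _ => ?_
  exact ((h.contDiffAt_secondFundamentalForm hx).clm_apply
    ((h.left.contDiffAt_inverse hx).clm_apply contDiffAt_const)).clm_apply contDiffAt_const

theorem contDiffAt_tensionSq (h : IsHypersurfaceOn g G φ U V c) (hx : x ∈ U) :
    ContDiffAt ℝ ∞ (tensionSq g G φ) x :=
  (((h.right.contDiffAt (h.mapsTo x hx)).comp x (h.contDiffAt hx)).clm_apply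
    (h.contDiffAt_tension hx)).clm_apply (h.contDiffAt_tension hx)

theorem contDiffAt_tensionShape (h : IsHypersurfaceOn g G φ U V c) (hx : x ∈ U) :
    ContDiffAt ℝ ∞ (tensionShape g G φ) x := by
  have h1 : ContDiffAt ℝ ∞ (fun t => G (φ t) (tension g G φ t)) x :=
    ((h.right.contDiffAt (h.mapsTo x hx)).comp x (h.contDiffAt hx)).clm_apply
      (h.contDiffAt_tension hx)
  have h2 : ContDiffAt ℝ ∞ (fun t => ContinuousLinearMap.compL ℝ (Coord m) (Coord (m + 1)) ℝ
      (G (φ t) (tension g G φ t))) x :=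
    ((ContinuousLinearMap.compL ℝ (Coord m) (Coord (m + 1)) ℝ).contDiff.contDiffAt).comp x h1
  exact (h.left.contDiffAt_inverse hx).clm_comp
    (h2.clm_comp (h.contDiffAt_secondFundamentalForm hx))

theorem covDerivAlong_fderiv (h : IsHypersurfaceOn g G φ U V c) (hx : x ∈ U) (u v : Coord m) :
    covDerivAlong G φ (fun t => fderiv ℝ φ t v) x u
      = secondFundamentalForm g G φ x u v + fderiv ℝ φ x (christoffel g x u v) := by
  have := (IsMetricOn.fderiv_fderiv_apply ((h.contDiffAt hx).of_le two_le_infty) v).fderiv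
  rw [covDerivAlong, this, secondFundamentalForm_apply]
  simp

theorem secondFundamentalForm_symm (h : IsHypersurfaceOn g G φ U V c) (hx : x ∈ U)
    (u v : Coord m) :
    secondFundamentalForm g G φ x u v = secondFundamentalForm g G φ x v u := by
  rw [secondFundamentalForm_apply, secondFundamentalForm_apply,
    IsMetricOn.fderiv_fderiv_symm ((h.contDiffAt hx).of_le two_le_infty),
    h.right.christoffel_symm (h.mapsTo x hx), h.left.christoffel_symm hx]

/-- The form S(u, v, w) = ⟨∇̃_u(dφ v), dφ w⟩ is symmetric in `u`, `v`, and S(u, v, w) + S(u, w, v)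
is the derivative of `g(v, w)` along `u`. The Koszul formula has only one solution, so S(u, v, w) =
⟨∇_u v, w⟩ and nothing tangential is left in B. -/
theorem inner_secondFundamentalForm (h : IsHypersurfaceOn g G φ U V c) (hx : x ∈ U)
    (u v w : Coord m) :
    G (φ x) (secondFundamentalForm g G φ x u v) (fderiv ℝ φ x w) = 0 := by
  have hd : ∀ v, DifferentiableAt ℝ (fun t => fderiv ℝ φ t v) x := fun v =>
    ((h.contDiffAt_fderiv hx).differentiableAt (by simp)).clm_apply (differentiableAt_const v)
  have hs := h.right.symm _ (h.mapsTo x hx)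
  set S : Coord m → Coord m → Coord m → ℝ := fun u v w =>
    G (φ x) (covDerivAlong G φ (fun t => fderiv ℝ φ t v) x u) (fderiv ℝ φ x w) with hS
  have h1 : ∀ u v w, fderiv ℝ g x u v w = S u v w + S u w v := by
    intro u v w
    have e := h.right.fderiv_inner (h.mapsTo x hx) ((h.contDiffAt hx).differentiableAt (by simp))
      (hd v) (hd w) u
    have e2 : (fun t => G (φ t) (fderiv ℝ φ t v) (fderiv ℝ φ t w)) =ᶠ[nhds x]
        fun t => g t v w := by
      filter_upwards [h.left.isOpen.mem_nhds hx] with t ht using h.isometry t ht v w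
    have e3 := (((h.left.differentiableAt hx).hasFDerivAt.clm_apply
      (hasFDerivAt_const v x)).clm_apply (hasFDerivAt_const w x)).fderiv
    rw [e2.fderiv_eq, e3] at e
    simp only [hS]
    rw [← hs (fderiv ℝ φ x v), ← e]
    simp
  have h2 : ∀ u v w, S u v w = S v u w := by
    intro u v w
    simp only [hS, h.covDerivAlong_fderiv hx]
    rw [h.secondFundamentalForm_symm hx, h.left.christoffel_symm hx]
  have h3 : S u v w = g x (christoffel g x u v) w := by
    rw [h.left.apply_christoffel hx, h1, h1, h1, h2 u v w, h2 w u v, h2 w v u]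
    ring
  have h4 : S u v w = G (φ x) (secondFundamentalForm g G φ x u v) (fderiv ℝ φ x w)
      + g x (christoffel g x u v) w := by
    simp only [hS, h.covDerivAlong_fderiv hx]
    rw [map_add, add_apply, h.isometry x hx]
  linarith

theorem inner_tension_fderiv (h : IsHypersurfaceOn g G φ U V c) (hx : x ∈ U) (w : Coord m) :
    G (φ x) (tension g G φ x) (fderiv ℝ φ x w) = 0 := by
  simp only [tension, metricTrace, map_sum, sum_apply,
    h.inner_secondFundamentalForm hx, Finset.sum_const_zero]

theorem inner_tensionShape (h : IsHypersurfaceOn g G φ U V c) (hx : x ∈ U) (u v : Coord m) :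
    g x (tensionShape g G φ x u) v
      = G (φ x) (tension g G φ x) (secondFundamentalForm g G φ x u v) := by
  rw [tensionShape, shapeOperator_apply, h.left.apply_inverse hx]; rfl

theorem tensionShape_symm (h : IsHypersurfaceOn g G φ U V c) (hx : x ∈ U) (u v : Coord m) :
    g x (tensionShape g G φ x u) v = g x u (tensionShape g G φ x v) := by
  rw [h.left.symm x hx u, h.inner_tensionShape hx, h.inner_tensionShape hx,
    h.secondFundamentalForm_symm hx]

/-- The trace of ⟨τ, B⟩ is ⟨τ, tr B⟩ = ⟨τ, τ⟩. Not normalising the normal field makes κ both its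
squared length and the trace of A. -/
theorem endTrace_tensionShape (h : IsHypersurfaceOn g G φ U V c) (hx : x ∈ U) :
    endTrace m (tensionShape g G φ x) = tensionSq g G φ x := by
  rw [h.left.endTrace_eq' hx]
  simp only [h.inner_tensionShape hx]
  rw [← map_sum]; rfl

theorem fderiv_injective (h : IsHypersurfaceOn g G φ U V c) (hx : x ∈ U) {u : Coord m}
    (hu : ∀ w, G (φ x) (fderiv ℝ φ x u) (fderiv ℝ φ x w) = 0) : u = 0 :=
  h.left.nondegenerate x hx u fun w => by rw [← h.isometry x hx, hu]

/-- Codimension one: (u, s) ↦ dφ u + s ξ is injective, because pairing with tangent vectors recovers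
`u`, and both sides have dimension m + 1. -/
theorem exists_eq_add_smul (h : IsHypersurfaceOn g G φ U V c) (hx : x ∈ U) {ξ : Coord (m + 1)}
    (hξ : ξ ≠ 0) (hn : ∀ w, G (φ x) ξ (fderiv ℝ φ x w) = 0) (X : Coord (m + 1)) :
    ∃ (u : Coord m) (s : ℝ), X = fderiv ℝ φ x u + s • ξ := by
  let L : (Coord m × ℝ) →ₗ[ℝ] Coord (m + 1) :=
    (fderiv ℝ φ x : Coord m →ₗ[ℝ] Coord (m + 1)).coprod (LinearMap.toSpanSingleton ℝ _ ξ)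
  have hL : ∀ u s, L (u, s) = fderiv ℝ φ x u + s • ξ := by
    intro u s; simp [L]
  have hinj : Function.Injective L := by
    rw [injective_iff_map_eq_zero]
    rintro ⟨u, s⟩ hus
    rw [hL] at hus
    have hu : u = 0 := h.fderiv_injective hx fun w => by
      have := congrArg (fun a => G (φ x) a (fderiv ℝ φ x w)) hus
      simpa [hn w] using this
    subst hu
    have : s = 0 := by simpa [hξ] using hus
    simp [this]
  have hdim : Module.finrank ℝ (Coord m × ℝ) = Module.finrank ℝ (Coord (m + 1)) := by simp
  obtain ⟨⟨u, s⟩, hus⟩ := (LinearMap.injective_iff_surjective_of_finrank_eq_finrank hdim).1 hinj X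
  exact ⟨u, s, by rw [← hus, hL]⟩

/-- A null normal vector would be orthogonal to the tangent space and to itself, hence to the whole
ambient space. -/
theorem inner_self_ne_zero (h : IsHypersurfaceOn g G φ U V c) (hx : x ∈ U) {ξ : Coord (m + 1)}
    (hξ : ξ ≠ 0) (hn : ∀ w, G (φ x) ξ (fderiv ℝ φ x w) = 0) : G (φ x) ξ ξ ≠ 0 := by
  intro h0
  refine hξ (h.right.nondegenerate _ (h.mapsTo x hx) ξ fun X => ?_)
  obtain ⟨u, s, rfl⟩ := h.exists_eq_add_smul hx hξ hn X
  simp [hn, h0]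

theorem tensionSq_ne_zero (h : IsHypersurfaceOn g G φ U V c) (hx : x ∈ U)
    (hτ : tension g G φ x ≠ 0) : tensionSq g G φ x ≠ 0 :=
  h.inner_self_ne_zero hx hτ (h.inner_tension_fderiv hx)

/-- A vector is determined by its tangential and its normal part. -/
theorem eq_of_add_smul_eq (h : IsHypersurfaceOn g G φ U V c) (hx : x ∈ U)
    (hκ : tensionSq g G φ x ≠ 0) {u v : Coord m} {s t : ℝ}
    (he : fderiv ℝ φ x u + s • tension g G φ x = fderiv ℝ φ x v + t • tension g G φ x) :
    u = v ∧ s = t := by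
  have hn := h.inner_tension_fderiv hx
  constructor
  · refine h.left.ext_left hx fun w => ?_
    have := congrArg (fun a => G (φ x) a (fderiv ℝ φ x w)) he
    simpa [hn w, h.isometry x hx] using this
  · have := congrArg (fun a => G (φ x) (tension g G φ x) a) he
    simp only [map_add, hn, map_smul, zero_add, smul_eq_mul] at this
    exact mul_right_cancel₀ hκ this

theorem eq_add_smul (h : IsHypersurfaceOn g G φ U V c) (hx : x ∈ U)
    (hκ : tensionSq g G φ x ≠ 0) {X : Coord (m + 1)} {u : Coord m} {s : ℝ}
    (hu : ∀ w, G (φ x) X (fderiv ℝ φ x w) = g x u w)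
    (hs : G (φ x) (tension g G φ x) X = s * tensionSq g G φ x) :
    X = fderiv ℝ φ x u + s • tension g G φ x := by
  have hn := h.inner_tension_fderiv hx
  have hτ : tension g G φ x ≠ 0 := by
    rintro h0; simp [tensionSq, h0] at hκ
  obtain ⟨v, t, rfl⟩ := h.exists_eq_add_smul hx hτ hn X
  have h1 : v = u := h.left.ext_left hx fun w => by
    rw [← hu w]; simp [hn w, h.isometry x hx]
  have h2 : t = s := by
    simp only [map_add, hn, map_smul, zero_add, smul_eq_mul] at hs
    exact mul_right_cancel₀ hκ hs
  rw [h1, h2]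

theorem secondFundamentalForm_eq (h : IsHypersurfaceOn g G φ U V c) (hx : x ∈ U)
    (hκ : tensionSq g G φ x ≠ 0) (u v : Coord m) : secondFundamentalForm g G φ x u v
      = (g x (tensionShape g G φ x u) v / tensionSq g G φ x) • tension g G φ x := by
  have := h.eq_add_smul hx hκ (X := secondFundamentalForm g G φ x u v) (u := 0)
    (s := g x (tensionShape g G φ x u) v / tensionSq g G φ x)
    (fun w => by rw [h.inner_secondFundamentalForm hx]; simp)
    (by rw [h.inner_tensionShape hx]; field_simp)
  simpa using this

/-- The Gauss formula. -/
theorem covDerivAlong_fderiv_apply (h : IsHypersurfaceOn g G φ U V c) (hx : x ∈ U)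
    (hκ : tensionSq g G φ x ≠ 0) {X : Coord m → Coord m} (hX : DifferentiableAt ℝ X x)
    (u : Coord m) : covDerivAlong G φ (fun t => fderiv ℝ φ t (X t)) x u
      = fderiv ℝ φ x (covDerivAlong g id X x u)
        + (g x (tensionShape g G φ x u) (X x) / tensionSq g G φ x) • tension g G φ x := by
  rw [← h.secondFundamentalForm_eq hx hκ]
  have hd : DifferentiableAt ℝ (fderiv ℝ φ) x :=
    (h.contDiffAt_fderiv hx).differentiableAt (by simp)
  have e := (hd.hasFDerivAt.clm_apply hX.hasFDerivAt).fderiv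
  rw [covDerivAlong, e, secondFundamentalForm_apply, covDerivAlong]
  simp
  abel

/-- The Weingarten formula. -/
theorem covDerivAlong_tension (h : IsHypersurfaceOn g G φ U V c) (hx : x ∈ U)
    (hκ : tensionSq g G φ x ≠ 0) (u : Coord m) :
    covDerivAlong G φ (tension g G φ) x u = fderiv ℝ φ x (-tensionShape g G φ x u)
      + (fderiv ℝ (tensionSq g G φ) x u / (2 * tensionSq g G φ x)) • tension g G φ x := by
  have hy := h.mapsTo x hx
  have hφ : DifferentiableAt ℝ φ x := (h.contDiffAt hx).differentiableAt (by simp)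
  have hτ : DifferentiableAt ℝ (tension g G φ) x :=
    (h.contDiffAt_tension hx).differentiableAt (by simp)
  refine h.eq_add_smul hx hκ (fun w => ?_) ?_
  · have hd : DifferentiableAt ℝ (fun t => fderiv ℝ φ t w) x :=
      ((h.contDiffAt_fderiv hx).differentiableAt (by simp)).clm_apply (differentiableAt_const w)
    have e := h.right.fderiv_inner hy hφ hτ hd u
    have e2 : (fun t => G (φ t) (tension g G φ t) (fderiv ℝ φ t w)) =ᶠ[nhds x] fun _ => 0 := by
      filter_upwards [h.left.isOpen.mem_nhds hx] with t ht using h.inner_tension_fderiv ht w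
    rw [e2.fderiv_eq, h.covDerivAlong_fderiv hx, map_add, h.inner_tension_fderiv hx,
      ← h.inner_tensionShape hx] at e
    simp only [fderiv_const_apply, map_neg, neg_apply, zero_apply] at e ⊢
    linarith
  · have e := h.right.fderiv_inner hy hφ hτ hτ u
    rw [h.right.symm _ hy (covDerivAlong _ _ _ _ _)] at e
    have e' : fderiv ℝ (tensionSq g G φ) x u = _ := e
    rw [e']
    field_simp
    ring

end IsHypersurfaceOn

/-! ### Codazzi and Gauss equations, and the two parts of the biharmonic equation -/

/-- The logarithmic derivative of the length of the tension field. -/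
noncomputable def tensionLogDeriv {m n : ℕ} (g : Coord m → Form m) (G : Coord n → Form n)
    (φ : Coord m → Coord n) (x u : Coord m) : ℝ :=
  fderiv ℝ (tensionSq g G φ) x u / (2 * tensionSq g G φ x)

namespace IsHypersurfaceOn

variable {m : ℕ} {g : Coord m → Form m} {G : Coord (m + 1) → Form (m + 1)}
  {φ : Coord m → Coord (m + 1)} {U : Set (Coord m)} {V : Set (Coord (m + 1))} {c : ℝ}
  {x : Coord m}

theorem differentiableAt_tensionLogDeriv (h : IsHypersurfaceOn g G φ U V c) (hx : x ∈ U)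
    (hκ : tensionSq g G φ x ≠ 0) (v : Coord m) :
    DifferentiableAt ℝ (fun t => tensionLogDeriv g G φ t v) x := by
  have h1 : DifferentiableAt ℝ (fderiv ℝ (tensionSq g G φ)) x :=
    ((h.contDiffAt_tensionSq hx).fderiv_right (m := ∞) (by simp)).differentiableAt (by simp)
  have h2 : DifferentiableAt ℝ (tensionSq g G φ) x :=
    (h.contDiffAt_tensionSq hx).differentiableAt (by simp)
  simp only [tensionLogDeriv, div_eq_mul_inv]
  exact (h1.clm_apply (differentiableAt_const v)).fun_mul
    ((h2.const_mul 2).fun_inv (mul_ne_zero two_ne_zero hκ))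

theorem differentiableAt_tensionShape (h : IsHypersurfaceOn g G φ U V c) (hx : x ∈ U) :
    DifferentiableAt ℝ (tensionShape g G φ) x :=
  (h.contDiffAt_tensionShape hx).differentiableAt (by simp)

/-- The second covariant derivative of the tension field. -/
theorem covHessianAlong_tension (h : IsHypersurfaceOn g G φ U V c)
    (hκ : ∀ t ∈ U, tensionSq g G φ t ≠ 0) (hx : x ∈ U) (u v : Coord m) :
    covHessianAlong g G φ (tension g G φ) x u v =
      fderiv ℝ φ x (-(covEnd g (tensionShape g G φ) x u v
        + tensionLogDeriv g G φ x v • tensionShape g G φ x u))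
      + (-(g x (tensionShape g G φ x u) (tensionShape g G φ x v) / tensionSq g G φ x)
        + fderiv ℝ (fun t => tensionLogDeriv g G φ t v) x u
        + tensionLogDeriv g G φ x v * tensionLogDeriv g G φ x u
        - tensionLogDeriv g G φ x (christoffel g x u v)) • tension g G φ x := by
  have hA := h.differentiableAt_tensionShape hx
  have hη := h.differentiableAt_tensionLogDeriv hx (hκ x hx) v
  have hτ : DifferentiableAt ℝ (tension g G φ) x :=
    (h.contDiffAt_tension hx).differentiableAt (by simp)
  have hAv : DifferentiableAt ℝ (fun t => -tensionShape g G φ t v) x :=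
    (hA.clm_apply (differentiableAt_const v)).neg
  have hdA : DifferentiableAt ℝ (fun t => fderiv ℝ φ t (-tensionShape g G φ t v)) x :=
    ((h.contDiffAt_fderiv hx).differentiableAt (by simp)).clm_apply hAv
  have e1 : (fun t => covDerivAlong G φ (tension g G φ) t v) =ᶠ[nhds x]
      fun t => fderiv ℝ φ t (-tensionShape g G φ t v)
        + tensionLogDeriv g G φ t v • tension g G φ t := by
    filter_upwards [h.left.isOpen.mem_nhds hx] with t ht
    exact h.covDerivAlong_tension ht (hκ t ht) v
  have e2 : covDerivAlong g id (fun t => -tensionShape g G φ t v) x u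
      = -(covEnd g (tensionShape g G φ) x u v
        + tensionShape g G φ x (christoffel g x u v)) := by
    rw [← covDerivAlong_end_apply hA]
    simp only [covDerivAlong, fderiv_fun_neg, neg_apply, map_neg]
    abel
  rw [covHessianAlong, covDerivAlong_congr e1, covDerivAlong_add hdA (hη.fun_smul hτ),
    covDerivAlong_smul hη hτ, h.covDerivAlong_fderiv_apply hx (hκ x hx) hAv, e2,
    h.covDerivAlong_tension hx (hκ x hx), h.covDerivAlong_tension hx (hκ x hx)]
  simp only [tensionLogDeriv, map_neg, map_add, map_smul]
  module

/-- The Codazzi equation. -/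
theorem codazzi (h : IsHypersurfaceOn g G φ U V c)
    (hκ : ∀ t ∈ U, tensionSq g G φ t ≠ 0) (hx : x ∈ U) (u v : Coord m) :
    covEnd g (tensionShape g G φ) x u v + tensionLogDeriv g G φ x v • tensionShape g G φ x u
      = covEnd g (tensionShape g G φ) x v u
        + tensionLogDeriv g G φ x u • tensionShape g G φ x v := by
  have hy := h.mapsTo x hx
  have e := h.right.covDerivAlong_comm hy ((h.contDiffAt hx).of_le two_le_infty)
    ((h.contDiffAt_tension hx).of_le two_le_infty) u v
  rw [h.curvature_eq _ hy, h.right.symm _ hy _ (tension g G φ x),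
    h.right.symm _ hy _ (tension g G φ x), h.inner_tension_fderiv hx,
    h.inner_tension_fderiv hx] at e
  -- In constant curvature R̃(dφ u, dφ v)τ is a combination of dφ u and dφ v with coefficients ⟨dφ
  -- v, τ⟩ and ⟨dφ u, τ⟩, so it vanishes. The second covariant derivative of τ is therefore
  -- symmetric, and its tangential part gives the claim.
  have e' : covHessianAlong g G φ (tension g G φ) x u v
      = covHessianAlong g G φ (tension g G φ) x v u := by
    rw [covHessianAlong, covHessianAlong, h.left.christoffel_symm hx v u, ← sub_eq_zero]
    simpa using e
  rw [h.covHessianAlong_tension hκ hx, h.covHessianAlong_tension hκ hx] at e'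
  exact neg_injective (h.eq_of_add_smul_eq hx (hκ x hx) e').1

/-- The Gauss equation. -/
theorem gauss (h : IsHypersurfaceOn g G φ U V c)
    (hκ : ∀ t ∈ U, tensionSq g G φ t ≠ 0) (hx : x ∈ U) (u v w : Coord m) :
    curvature g x u v w = c • (g x v w • u - g x u w • v)
      + (tensionSq g G φ x)⁻¹ • (g x (tensionShape g G φ x v) w • tensionShape g G φ x u
        - g x (tensionShape g G φ x u) w • tensionShape g G φ x v) := by
  have hy := h.mapsTo x hx
  have hA := h.differentiableAt_tensionShape hx
  have hτ : DifferentiableAt ℝ (tension g G φ) x :=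
    (h.contDiffAt_tension hx).differentiableAt (by simp)
  have hκd : DifferentiableAt ℝ (tensionSq g G φ) x :=
    (h.contDiffAt_tensionSq hx).differentiableAt (by simp)
  have hΓ : ∀ a b : Coord m, DifferentiableAt ℝ (fun t => christoffel g t a b) x := fun a b =>
    ((h.left.differentiableAt_christoffel hx).clm_apply (differentiableAt_const a)).clm_apply
      (differentiableAt_const b)
  have hc : ContDiffAt ℝ 2 (fun t => fderiv ℝ φ t w) x :=
    ((h.contDiffAt_fderiv hx).clm_apply contDiffAt_const).of_le two_le_infty
  -- Only the tangential part matters for the Gauss equation, so the normal coefficient `s` is left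
  -- unnamed.
  have key : ∀ u v, ∃ s : ℝ, covDerivAlong G φ
      (fun t => covDerivAlong G φ (fun t => fderiv ℝ φ t w) t v) x u =
      fderiv ℝ φ x (covDerivAlong g id (fun t => christoffel g t v w) x u
        - (g x (tensionShape g G φ x v) w / tensionSq g G φ x) • tensionShape g G φ x u)
      + s • tension g G φ x := by
    intro u v
    have e1 : (fun t => covDerivAlong G φ (fun t => fderiv ℝ φ t w) t v) =ᶠ[nhds x]
        fun t => fderiv ℝ φ t (christoffel g t v w)
          + (g t (tensionShape g G φ t v) w / tensionSq g G φ t) • tension g G φ t := by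
      filter_upwards [h.left.isOpen.mem_nhds hx] with t ht
      rw [h.covDerivAlong_fderiv ht, h.secondFundamentalForm_eq ht (hκ t ht)]
      exact add_comm _ _
    have hs : DifferentiableAt ℝ
        (fun t => g t (tensionShape g G φ t v) w / tensionSq g G φ t) x := by
      simp only [div_eq_mul_inv]
      exact (((h.left.differentiableAt hx).clm_apply (hA.clm_apply
        (differentiableAt_const v))).clm_apply (differentiableAt_const w)).fun_mul
          (hκd.fun_inv (hκ x hx))
    have hd : DifferentiableAt ℝ (fun t => fderiv ℝ φ t (christoffel g t v w)) x :=
      ((h.contDiffAt_fderiv hx).differentiableAt (by simp)).clm_apply (hΓ v w)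
    rw [covDerivAlong_congr e1, covDerivAlong_add hd (hs.fun_smul hτ), covDerivAlong_smul hs hτ,
      h.covDerivAlong_fderiv_apply hx (hκ x hx) (hΓ v w),
      h.covDerivAlong_tension hx (hκ x hx)]
    simp only [map_sub, map_neg, map_smul]
    have comb : ∀ (p q : Coord (m + 1)) (a b k d : ℝ),
        p + a • tension g G φ x + (b • tension g G φ x + k • (-q + d • tension g G φ x))
          = p - k • q + (a + b + k * d) • tension g G φ x := fun p q a b k d => by module
    exact ⟨_, comb _ _ _ _ _ _⟩
  obtain ⟨s, hs⟩ := key u v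
  obtain ⟨t, ht⟩ := key v u
  have e := h.right.covDerivAlong_comm hy ((h.contDiffAt hx).of_le two_le_infty) hc u v
  have hR : covDerivAlong g id (fun t => christoffel g t v w) x u
      - covDerivAlong g id (fun t => christoffel g t u w) x v = curvature g x u v w := by
    simp only [covDerivAlong, curvature, fderiv_id, id, ContinuousLinearMap.id_apply]
    abel
  rw [hs, ht, h.curvature_eq _ hy, h.isometry x hx, h.isometry x hx] at e
  have e2 : fderiv ℝ φ x ((covDerivAlong g id (fun t => christoffel g t v w) x u
        - (g x (tensionShape g G φ x v) w / tensionSq g G φ x) • tensionShape g G φ x u)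
        - (covDerivAlong g id (fun t => christoffel g t u w) x v
        - (g x (tensionShape g G φ x u) w / tensionSq g G φ x) • tensionShape g G φ x v))
      + (s - t) • tension g G φ x
      = fderiv ℝ φ x (c • (g x v w • u - g x u w • v)) + (0 : ℝ) • tension g G φ x := by
    rw [map_smul, map_sub _ (g x v w • u), map_smul, map_smul, ← e, map_sub]
    module
  have e3 := (h.eq_of_add_smul_eq hx (hκ x hx) e2).1
  rw [← hR, ← e3]
  simp only [div_eq_mul_inv]
  module

/-- The tangential and the normal part of the vanishing of the bitension field. -/
theorem bitension_components (h : IsHypersurfaceOn g G φ U V c)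
    (hκ : ∀ t ∈ U, tensionSq g G φ t ≠ 0) (hx : x ∈ U) (hbi : bitension g G φ x = 0) :
    (∑ i, (covEnd g (tensionShape g G φ) x (dualVec (g x) i) (stdVec i)
      + tensionLogDeriv g G φ x (stdVec i) • tensionShape g G φ x (dualVec (g x) i)) = 0) ∧
    ∑ i, (-(g x (tensionShape g G φ x (dualVec (g x) i)) (tensionShape g G φ x (stdVec i))
        / tensionSq g G φ x)
      + fderiv ℝ (fun t => tensionLogDeriv g G φ t (stdVec i)) x (dualVec (g x) i)
      + tensionLogDeriv g G φ x (stdVec i) * tensionLogDeriv g G φ x (dualVec (g x) i)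
      - tensionLogDeriv g G φ x (christoffel g x (dualVec (g x) i) (stdVec i))
      + c * g x (dualVec (g x) i) (stdVec i)) = 0 := by
  have hy := h.mapsTo x hx
  rw [bitension, roughLaplacian, neg_neg, metricTrace_eq, metricTrace_eq,
    ← Finset.sum_sub_distrib] at hbi
  have e : ∀ i : Fin m, covHessianAlong g G φ (tension g G φ) x (dualVec (g x) i) (stdVec i)
      - curvature G (φ x) (fderiv ℝ φ x (dualVec (g x) i)) (tension g G φ x)
          (fderiv ℝ φ x (stdVec i))
      = fderiv ℝ φ x (-(covEnd g (tensionShape g G φ) x (dualVec (g x) i) (stdVec i)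
          + tensionLogDeriv g G φ x (stdVec i) • tensionShape g G φ x (dualVec (g x) i)))
        + (-(g x (tensionShape g G φ x (dualVec (g x) i)) (tensionShape g G φ x (stdVec i))
            / tensionSq g G φ x)
          + fderiv ℝ (fun t => tensionLogDeriv g G φ t (stdVec i)) x (dualVec (g x) i)
          + tensionLogDeriv g G φ x (stdVec i) * tensionLogDeriv g G φ x (dualVec (g x) i)
          - tensionLogDeriv g G φ x (christoffel g x (dualVec (g x) i) (stdVec i))
          + c * g x (dualVec (g x) i) (stdVec i)) • tension g G φ x := by
    intro i
    rw [h.covHessianAlong_tension hκ hx, h.curvature_eq _ hy, h.isometry x hx,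
      h.inner_tension_fderiv hx]
    module
  simp only [e] at hbi
  rw [Finset.sum_add_distrib, ← map_sum, ← Finset.sum_smul] at hbi
  have := h.eq_of_add_smul_eq hx (hκ x hx) (v := 0) (t := 0) (by rw [hbi]; simp)
  refine ⟨?_, this.2⟩
  have h1 := this.1
  rwa [Finset.sum_neg_distrib, neg_eq_zero] at h1

/-- With η = dκ/(2κ), pair the tangential part of τ₂ = 0 with `w`. Codazzi and self-adjointness turn
the divergence of A into tr(∇_w A) + η(Aw) - κη(w), where tr(∇_w A) = dκ(w) = 2κη(w). The other
summand contributes a second η(Aw). -/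
theorem tensionSq_mul_add (h : IsHypersurfaceOn g G φ U V c)
    (hκ : ∀ t ∈ U, tensionSq g G φ t ≠ 0) (hx : x ∈ U) (hbi : bitension g G φ x = 0)
    (w : Coord m) : tensionSq g G φ x * tensionLogDeriv g G φ x w
      + 2 * tensionLogDeriv g G φ x (tensionShape g G φ x w) = 0 := by
  set A := tensionShape g G φ x with hA
  set η : Coord m → ℝ := tensionLogDeriv g G φ x with hη
  have hs := h.left.symm x hx
  have hAd := h.differentiableAt_tensionShape hx
  have h1 := (h.bitension_components hκ hx hbi).1
  have h2 := congrArg (fun a => g x a w) h1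
  simp only [map_sum, sum_apply, map_add, add_apply, map_smul, smul_apply, smul_eq_mul,
    Finset.sum_add_distrib, map_zero, zero_apply] at h2
  have hηlin : ∀ v, ∑ i, η (stdVec i) * g x (dualVec (g x) i) v = η v := by
    intro v
    conv_rhs => rw [← sum_smul_stdVec v]
    simp only [hη, tensionLogDeriv, map_sum, map_smul, Finset.sum_div, smul_eq_mul]
    refine Finset.sum_congr rfl fun i _ => ?_
    rw [h.left.dualVec_apply hx]; ring
  have hηlin' : ∀ v, ∑ i, η (dualVec (g x) i) * g x v (stdVec i) = η v := by
    intro v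
    -- Representing η by a vector turns the sum over the dual basis into `sum_dualVec_stdVec`.
    obtain ⟨Y, hY⟩ : ∃ Y, ∀ v, g x Y v = η v := by
      refine ⟨(g x).inverse ((2 * tensionSq g G φ x)⁻¹ • fderiv ℝ (tensionSq g G φ) x),
        fun v => ?_⟩
      rw [h.left.apply_inverse hx]
      simp [hη, tensionLogDeriv, div_eq_inv_mul]
    rw [← hY v, ← h.left.sum_dualVec_stdVec hx]
    exact Finset.sum_congr rfl fun i _ => by rw [hY, hs v]
  have e1 : ∑ i, η (stdVec i) * g x (A (dualVec (g x) i)) w = η (A w) := by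
    rw [← hηlin]
    exact Finset.sum_congr rfl fun i _ => by rw [h.tensionShape_symm hx]
  have e2 : ∑ i, g x (covEnd g (tensionShape g G φ) x (dualVec (g x) i) (stdVec i)) w
      = endTrace m (covEnd g (tensionShape g G φ) x w) + η (A w)
        - η w * tensionSq g G φ x := by
    rw [← h.endTrace_tensionShape hx, h.left.endTrace_eq' hx, h.left.endTrace_eq' hx,
      ← hηlin', Finset.mul_sum, ← Finset.sum_add_distrib, ← Finset.sum_sub_distrib]
    refine Finset.sum_congr rfl fun i _ => ?_
    rw [h.left.covEnd_symm hx hAd (fun t ht => h.tensionShape_symm ht), hs]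
    have := h.codazzi hκ hx w (dualVec (g x) i)
    rw [← hA] at this
    have := congrArg (fun a => g x a (stdVec i)) this
    simp only [map_add, add_apply, map_smul, smul_apply, smul_eq_mul] at this
    linarith
  have e3 : endTrace m (covEnd g (tensionShape g G φ) x w)
      = 2 * tensionSq g G φ x * η w := by
    rw [endTrace_covEnd hAd]
    have : (fun t => endTrace m (tensionShape g G φ t)) =ᶠ[nhds x] tensionSq g G φ := by
      filter_upwards [h.left.isOpen.mem_nhds hx] with t ht using h.endTrace_tensionShape ht
    rw [this.fderiv_eq]
    have := hκ x hx
    simp only [hη, tensionLogDeriv]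
    field_simp
  have h2' : ∑ i, g x (covEnd g (tensionShape g G φ) x (dualVec (g x) i) (stdVec i)) w
    + ∑ i, η (stdVec i) * g x (A (dualVec (g x) i)) w = 0 := h2
  rw [e1, e2, e3] at h2'
  linarith

/-- A biharmonic hypersurface without real principal curvatures has constant mean curvature. -/
theorem tensionLogDeriv_eq_zero (h : IsHypersurfaceOn g G φ U V c)
    (hκ : ∀ t ∈ U, tensionSq g G φ t ≠ 0) (hx : x ∈ U) (hbi : bitension g G φ x = 0)
    (hreal : ∀ (μ : ℝ) (v : Coord m), tensionShape g G φ x v = μ • v → v = 0) :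
    fderiv ℝ (tensionSq g G φ) x = 0 := by
  have hκx := hκ x hx
  set Y := (g x).inverse (fderiv ℝ (tensionSq g G φ) x) with hYdef
  have hY : ∀ v, g x Y v = fderiv ℝ (tensionSq g G φ) x v := fun v => by
    rw [h.left.apply_inverse hx]
  have h0 : Y = 0 := by
    -- `tensionSq_mul_add` reads κ⟨Y, w⟩ + 2⟨Y, Aw⟩ = 0 for the gradient `Y`, that is, AY = -(κ/2)Y.
    refine hreal (-(tensionSq g G φ x / 2)) Y (h.left.ext_left hx fun w => ?_)
    have e := h.tensionSq_mul_add hκ hx hbi w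
    simp only [tensionLogDeriv, ← hY] at e
    rw [h.tensionShape_symm hx, map_smul, smul_apply, smul_eq_mul]
    field_simp at e
    linarith
  ext v
  rw [← hY, h0]; simp

/-- The normal part of the bitension field for constant mean curvature. -/
theorem endTrace_sq (h : IsHypersurfaceOn g G φ U V c)
    (hκ : ∀ t ∈ U, tensionSq g G φ t ≠ 0) (hx : x ∈ U) (hbi : bitension g G φ x = 0)
    (h0 : ∀ t ∈ U, fderiv ℝ (tensionSq g G φ) t = 0) :
    endTrace m ((tensionShape g G φ x).comp (tensionShape g G φ x))
      = m * c * tensionSq g G φ x := by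
  have hη : ∀ t ∈ U, ∀ v, tensionLogDeriv g G φ t v = 0 := by
    intro t ht v
    simp [tensionLogDeriv, h0 t ht]
  have h2 := (h.bitension_components hκ hx hbi).2
  have hd : ∀ v, fderiv ℝ (fun t => tensionLogDeriv g G φ t v) x = 0 := by
    intro v
    have : (fun t => tensionLogDeriv g G φ t v) =ᶠ[nhds x] fun _ => 0 := by
      filter_upwards [h.left.isOpen.mem_nhds hx] with t ht using hη t ht v
    rw [this.fderiv_eq]; simp
  simp only [hη x hx, hd, h.tensionShape_symm hx, zero_apply, add_zero, mul_zero, sub_zero,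
    Finset.sum_add_distrib, Finset.sum_neg_distrib, ← Finset.mul_sum, ← Finset.sum_div] at h2
  have e1 := h.left.endTrace_eq hx (ContinuousLinearMap.id ℝ (Coord m))
  have e1' : endTrace m (ContinuousLinearMap.id ℝ (Coord m)) = m := by
    rw [endTrace_apply]
    simp
  have e2 := h.left.endTrace_eq hx ((tensionShape g G φ x).comp (tensionShape g G φ x))
  simp only [ContinuousLinearMap.comp_apply, ContinuousLinearMap.id_apply] at e1 e2
  rw [← e1, e1', ← e2] at h2
  have := hκ x hx
  field_simp at h2
  linarith

end IsHypersurfaceOn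

/-! ### The decomposition A = a + bJ + n and operators commuting with J -/

section Jordan

variable {R : Type*} [Ring R] [Algebra ℝ R]

/-- The semisimple part `J` of `S / b` if `(S² + b²)² = 0`. -/
noncomputable def complexPart (b : ℝ) (S : R) : R :=
  b⁻¹ • (S + (2 * b ^ 2)⁻¹ • (S * (S * S + b ^ 2 • (1 : R))))

/-- The nilpotent part of `S` if `(S² + b²)² = 0`. -/
noncomputable def nilPart (b : ℝ) (S : R) : R := S - b • complexPart b S

theorem complexPart_commute (b : ℝ) (S : R) : complexPart b S * S = S * complexPart b S := by
  simp only [complexPart, mul_add, add_mul, smul_mul_assoc, mul_smul_comm, mul_assoc, mul_one]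

/-- With Q = S² + b² and Q² = 0 one has -S²/b² = 1 - Q/b², whose inverse square root is exactly 1 +
Q/(2b²). Multiplying S/b by it gives an operator with square -(1 - Q/b²)(1 + Q/b²) = -1. -/
theorem complexPart_mul_self {b : ℝ} (hb : b ≠ 0) {S : R}
    (hS : (S * S + b ^ 2 • (1 : R)) * (S * S + b ^ 2 • (1 : R)) = 0) :
    complexPart b S * complexPart b S = -1 := by
  obtain ⟨Q, hQ⟩ : ∃ Q, Q = S * S + b ^ 2 • (1 : R) := ⟨_, rfl⟩
  have hSS : S * S = Q - b ^ 2 • (1 : R) := by rw [hQ]; abel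
  have hQS : Q * S = S * Q := by
    rw [hQ]; simp only [add_mul, mul_add, smul_mul_assoc, mul_smul_comm, mul_assoc, mul_one, one_mul]
  rw [← hQ] at hS
  rw [complexPart, ← hQ]
  have h1 : ∀ X, S * (S * X) = Q * X - b ^ 2 • X := fun X => by
    rw [← mul_assoc, hSS, sub_mul, smul_mul_assoc, one_mul]
  have h2 : ∀ X, Q * (S * X) = S * (Q * X) := fun X => by
    rw [← mul_assoc, hQS, mul_assoc]
  simp only [mul_add, add_mul, smul_mul_assoc, mul_smul_comm, mul_assoc, hSS, hQS, h1, h2, hS,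
    mul_zero, smul_add, smul_smul, smul_sub]
  match_scalars <;> field_simp
  ring

/-- The difference S - bJ equals -SQ/(2b²) with Q = S² + b². Since S and Q commute, its square
contains Q² = 0. -/
theorem nilPart_mul_self {b : ℝ} (hb : b ≠ 0) {S : R}
    (hS : (S * S + b ^ 2 • (1 : R)) * (S * S + b ^ 2 • (1 : R)) = 0) :
    nilPart b S * nilPart b S = 0 := by
  obtain ⟨Q, hQ⟩ : ∃ Q, Q = S * S + b ^ 2 • (1 : R) := ⟨_, rfl⟩
  have hQS : Q * S = S * Q := by
    rw [hQ]; simp only [add_mul, mul_add, smul_mul_assoc, mul_smul_comm, mul_assoc, mul_one, one_mul]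
  rw [← hQ] at hS
  have hn : nilPart b S = -((2 * b ^ 2)⁻¹ • (S * Q)) := by
    rw [nilPart, complexPart, ← hQ, smul_smul, mul_inv_cancel₀ hb, one_smul]; abel
  rw [hn, neg_mul_neg, smul_mul_smul_comm, mul_assoc, ← mul_assoc Q, hQS, mul_assoc S, hS]
  simp

theorem complexPart_mul_nilPart (b : ℝ) (S : R) :
    complexPart b S * nilPart b S = nilPart b S * complexPart b S := by
  simp only [nilPart, mul_sub, sub_mul, complexPart_commute, smul_mul_assoc, mul_smul_comm]

/-- The part of `C` commuting with a complex structure `J` inherits anticommutation with a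
nilpotent operator. -/
theorem commutingPart_anticomm {J n CJ Cn : R} {b : ℝ} (hJ : J * J = -1) (hJn : J * n = n * J)
    (hCJ : CJ * J + J * CJ = 0) (hCn : Cn * n + n * Cn = 0) :
    ((b • CJ + Cn) - J * (b • CJ + Cn) * J = Cn - J * Cn * J) ∧
    (Cn - J * Cn * J) * n = -(n * (Cn - J * Cn * J)) := by
  constructor
  · have : J * CJ * J = CJ := by
      rw [eq_neg_of_add_eq_zero_right hCJ, neg_mul, mul_assoc, hJ]; simp
    simp only [mul_add, add_mul, mul_smul_comm, smul_mul_assoc, this]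
    abel
  · rw [eq_neg_iff_add_eq_zero, sub_mul, mul_sub]
    have e1 : J * Cn * J * n = J * (Cn * n) * J := by
      rw [mul_assoc (J * Cn), hJn]; simp only [mul_assoc]
    have e2 : n * (J * Cn * J) = J * (n * Cn) * J := by
      rw [mul_assoc J, ← mul_assoc n, ← hJn]; simp only [mul_assoc]
    rw [e1, e2]
    have : Cn * n - J * (Cn * n) * J + (n * Cn - J * (n * Cn) * J)
      = (Cn * n + n * Cn) - J * (Cn * n + n * Cn) * J := by
      simp only [mul_add, add_mul]; abel
    rw [this, hCn]; simp

end Jordan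

/-- `C - J C J` is twice the projection of `C` onto the operators commuting with `J`. -/
theorem commutingPart_comm {R : Type*} [Ring R] {J C : R} (hJ : J * J = -1) :
    (C - J * C * J) * J = J * (C - J * C * J) := by
  simp only [sub_mul, mul_sub, mul_assoc, hJ]
  rw [← mul_assoc J J, hJ]
  simp [add_comm]

theorem endTrace_mul_comm {n : ℕ} (S T : Coord n →L[ℝ] Coord n) :
    endTrace n (S * T) = endTrace n (T * S) := endTrace_comp_comm S T

/-- Regarding `J` as multiplication by i, the product of the commuting parts is complex linear. The
two identities express the vanishing of the real and imaginary parts of its complex trace, expanded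
by cyclicity. -/
theorem endTrace_commutingPart {n : ℕ} {J C C' : Coord n →L[ℝ] Coord n} (hJ : J * J = -1)
    (h : (C - J * C * J) * (C' - J * C' * J) = 0) :
    endTrace n (C * C') = endTrace n (C * J * C' * J) ∧
    endTrace n (J * C * C') + endTrace n (C * J * C') = 0 := by
  have hJJ : ∀ X, J * (J * X) = -X := fun X => by rw [← mul_assoc, hJ, neg_one_mul]
  constructor
  · have e : (C - J * C * J) * (C' - J * C' * J)
        = C * C' - C * J * C' * J - J * (C * J * C') - J * (C * C' * J) := by
      simp only [sub_mul, mul_sub, mul_assoc, hJJ]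
      simp only [mul_neg]; abel
    rw [e] at h
    have h' := congrArg (endTrace n) h
    simp only [map_sub, map_zero, endTrace_mul_comm J] at h'
    have : C * C' * J * J = -(C * C') := by rw [mul_assoc, hJ]; simp
    rw [this, map_neg] at h'
    linarith
  · have e : J * ((C - J * C * J) * (C' - J * C' * J))
        = J * C * C' - J * (C * J * C' * J) + C * J * C' + C * C' * J := by
      simp only [sub_mul, mul_sub, mul_assoc, hJJ]
      simp only [mul_neg]; abel
    rw [h, mul_zero] at e
    have h' := congrArg (endTrace n) e
    simp only [map_sub, map_add, map_zero, endTrace_mul_comm J (C * J * C' * J)] at h'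
    have e1 : C * J * C' * J * J = -(C * J * C') := by rw [mul_assoc, hJ]; simp
    rw [e1, map_neg, endTrace_mul_comm (C * C') J, ← mul_assoc] at h'
    linarith

/-- Self-adjoint operators on a four-dimensional space which commute with a complex structure
and anticommute with a nonzero nilpotent complex linear operator have vanishing products. -/
theorem mul_eq_zero_of_anticomm {B : Form 4} (hB : ∀ v w, B v w = B w v)
    (hnd : ∀ v, (∀ w, B v w = 0) → v = 0) {J n : Coord 4 →L[ℝ] Coord 4} (hJ : J * J = -1)
    (hn : n * n = 0) (hJn : J * n = n * J) (hn0 : n ≠ 0)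
    (hJs : ∀ v w, B (J v) w = B v (J w)) (hns : ∀ v w, B (n v) w = B v (n w))
    {D D' : Coord 4 →L[ℝ] Coord 4} (hD : ∀ v w, B (D v) w = B v (D w))
    (hD' : ∀ v w, B (D' v) w = B v (D' w)) (hDJ : D * J = J * D) (hD'J : D' * J = J * D')
    (hDn : D * n = -(n * D)) (hD'n : D' * n = -(n * D')) : D * D' = 0 := by
  have aJ : ∀ v, J (J v) = -v := fun v => by
    simpa using congrArg (fun T : Coord 4 →L[ℝ] Coord 4 => T v) hJ
  have an : ∀ v, n (n v) = 0 := fun v => by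
    simpa using congrArg (fun T : Coord 4 →L[ℝ] Coord 4 => T v) hn
  have aJn : ∀ v, n (J v) = J (n v) := fun v => by
    simpa using (congrArg (fun T : Coord 4 →L[ℝ] Coord 4 => T v) hJn).symm
  -- The symmetric form B(n·, ·) is nonzero, so by polarisation it is not isotropic everywhere. Such
  -- a `w` yields the basis w, Jw, nw, Jnw of the four-dimensional space.
  obtain ⟨w, hw⟩ : ∃ w, B (n w) w ≠ 0 := by
    by_contra! hcon
    refine hn0 (ContinuousLinearMap.ext fun u => hnd _ fun v => ?_)
    have e := hcon (u + v)
    simp only [map_add, add_apply, hcon] at e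
    rw [hns v u, hB v] at e
    linarith
  have hv0 : n w ≠ 0 := by
    intro h0; rw [h0] at hw; simp at hw
  have hz : ∀ x y : ℝ, x • n w + y • J (n w) = 0 → x = 0 ∧ y = 0 := by
    intro x y h
    have h2 := congrArg J h
    simp only [map_add, map_smul, aJ, map_zero] at h2
    have h3 : (x ^ 2 + y ^ 2) • n w = 0 := by
      have e : (x ^ 2 + y ^ 2) • n w = x • (x • n w + y • J (n w))
        - y • (x • J (n w) + y • -n w) := by module
      rw [e, h, h2]; simp
    have h4 := (smul_eq_zero.1 h3).resolve_right hv0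
    constructor <;> nlinarith [sq_nonneg x, sq_nonneg y]
  have hspan : ∀ e, ∃ x y z t : ℝ, e = x • w + y • J w + z • n w + t • J (n w) := by
    let L : (ℝ × ℝ × ℝ × ℝ) →ₗ[ℝ] Coord 4 :=
      (LinearMap.toSpanSingleton ℝ _ w).coprod ((LinearMap.toSpanSingleton ℝ _ (J w)).coprod
        ((LinearMap.toSpanSingleton ℝ _ (n w)).coprod
          (LinearMap.toSpanSingleton ℝ _ (J (n w)))))
    have hL : ∀ x y z t, L (x, y, z, t) = x • w + y • J w + z • n w + t • J (n w) := by
      intro x y z t; simp [L]; abel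
    have hinj : Function.Injective L := by
      rw [injective_iff_map_eq_zero]
      rintro ⟨x, y, z, t⟩ h
      rw [hL] at h
      have h1 := congrArg n h
      simp only [map_add, map_smul, aJn, an, map_zero, smul_zero, add_zero] at h1
      obtain ⟨rfl, rfl⟩ := hz x y h1
      simp only [zero_smul, zero_add] at h
      obtain ⟨rfl, rfl⟩ := hz z t h
      rfl
    intro e
    obtain ⟨⟨x, y, z, t⟩, h⟩ :=
      (LinearMap.injective_iff_surjective_of_finrank_eq_finrank (by simp)).1 hinj e
    exact ⟨x, y, z, t, by rw [← h, hL]⟩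
  -- Let x, y be the coefficients of `D w` on w, Jw. Anticommutation gives D(nw) = -(x nw + y Jnw).
  -- Self-adjointness tested on nw and Jnw is a linear system for (x, y) with determinant -(B(w,nw)²
  -- + B(w,Jnw)²) ≠ 0. So D sends w, Jw into the span of nw, Jnw and kills that span, which makes
  -- products vanish.
  have key : ∀ D : Coord 4 →L[ℝ] Coord 4, (∀ v w, B (D v) w = B v (D w)) → D * J = J * D →
      D * n = -(n * D) → (∀ v, D (J v) = J (D v)) ∧ D (n w) = 0 ∧
      ∃ z t : ℝ, D w = z • n w + t • J (n w) := by
    intro D hD hDJ hDn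
    have aDJ : ∀ v, D (J v) = J (D v) := fun v => by
      simpa using congrArg (fun T : Coord 4 →L[ℝ] Coord 4 => T v) hDJ
    have aDn : ∀ v, D (n v) = -n (D v) := fun v => by
      simpa using congrArg (fun T : Coord 4 →L[ℝ] Coord 4 => T v) hDn
    obtain ⟨x, y, z, t, hDw⟩ := hspan (D w)
    have hDv : D (n w) = -(x • n w + y • J (n w)) := by
      rw [aDn, hDw]; simp [aJn, an]
    have hvv : B (n w) (n w) = 0 := by rw [hns, an]; simp
    have hJvv : B (J (n w)) (n w) = 0 := by rw [← aJn, hns, an]; simp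
    have hβ : B (J w) (n w) = B w (J (n w)) := hJs _ _
    have hJJ : B (J w) (J (n w)) = -B w (n w) := by rw [hJs, aJ]; simp
    have e1 := hD w (n w)
    rw [hDv, hDw] at e1
    simp only [map_add, map_smul, add_apply, smul_apply, smul_eq_mul, hvv, hJvv, map_neg,
      hβ] at e1
    have e2 := hD w (J (n w))
    rw [aDJ, hDv, hDw] at e2
    have hJvv' : B (n w) (J (n w)) = 0 := by rw [hB, hJvv]
    have hJvJv : B (J (n w)) (J (n w)) = 0 := by rw [hJs, aJ]; simp [hvv]
    simp only [map_add, map_smul, add_apply, smul_apply, smul_eq_mul, map_neg,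
      hJJ, hJvv', hJvJv, aJ] at e2
    have hα : B w (n w) ≠ 0 := by rw [hB]; exact hw
    have e3 : (x ^ 2 + y ^ 2) * (B w (n w) ^ 2 + B w (J (n w)) ^ 2) = 0 := by
      have f1 : x * B w (n w) + y * B w (J (n w)) = 0 := by linarith
      have f2 : x * B w (J (n w)) - y * B w (n w) = 0 := by linarith
      have : (x ^ 2 + y ^ 2) * (B w (n w) ^ 2 + B w (J (n w)) ^ 2)
        = (x * B w (n w) + y * B w (J (n w))) ^ 2 + (x * B w (J (n w)) - y * B w (n w)) ^ 2 := by
        ring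
      rw [this, f1, f2]; ring
    have e4 : x ^ 2 + y ^ 2 = 0 :=
      (mul_eq_zero.1 e3).resolve_right (by positivity)
    have hx : x = 0 := by nlinarith [sq_nonneg x, sq_nonneg y]
    have hy : y = 0 := by nlinarith [sq_nonneg x, sq_nonneg y]
    subst hx hy
    exact ⟨aDJ, by rw [hDv]; simp, z, t, by rw [hDw]; simp⟩
  obtain ⟨k1, k2, -⟩ := key D hD hDJ hDn
  obtain ⟨k1', k2', z', t', k3'⟩ := key D' hD' hD'J hD'n
  ext1 e
  obtain ⟨x, y, z, t, rfl⟩ := hspan e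
  simp [k1', k2', k3', k1, k2]

/-- The squared length of a totally symmetric trilinear form vanishes if the parts of its
contractions commuting with `J` have vanishing traces. -/
theorem IsMetricOn.sum_endTrace_mul_eq_zero {m : ℕ} {g : Coord m → Form m} {U : Set (Coord m)}
    (hg : IsMetricOn g U) {x : Coord m} (hx : x ∈ U) {J : Coord m →L[ℝ] Coord m}
    (hJ : ∀ v w, g x (J v) w = g x v (J w)) {C : Coord m → Coord m →L[ℝ] Coord m}
    (hC : ∀ u v w, g x (C u v) w = g x v (C u w)) (hsym : ∀ u v, C u v = C v u)
    (h0 : ∀ u v, endTrace m (C u * C v) = endTrace m (C u * J * C v * J))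
    (h1 : ∀ u v, endTrace m (J * C u * C v) + endTrace m (C u * J * C v) = 0) :
    ∑ i, endTrace m (C (stdVec i) * C (dualVec (g x) i)) = 0 := by
  have hs := hg.symm x hx
  -- Total symmetry of ⟨C_u v, w⟩ allows the last `J` to be moved onto the summation index.
  have e1 : ∑ i, endTrace m (C (stdVec i) * J * C (dualVec (g x) i) * J)
      = ∑ i, endTrace m (C (J (stdVec i)) * J * C (dualVec (g x) i)) := by
    simp only [hg.endTrace_eq hx]
    rw [Finset.sum_comm]
    refine Finset.sum_congr rfl fun k _ => Finset.sum_congr rfl fun i _ => ?_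
    simp only [mul_apply_eq_comp]
    rw [← hC, ← hJ, hsym _ (dualVec (g x) k), hsym _ (J (stdVec k)), ← hC, hs]
  -- An operator and its adjoint have the same trace; cyclicity then aligns the factors. Hence the
  -- two terms of `h1` at (J e_i, eⁱ) are equal, and their sum over `i` vanishes.
  have e2 : ∀ i, endTrace m (J * C (J (stdVec i)) * C (dualVec (g x) i))
      = endTrace m (C (J (stdVec i)) * J * C (dualVec (g x) i)) := by
    intro i
    rw [endTrace_mul_comm, hg.endTrace_eq hx, hg.endTrace_eq' hx]
    refine Finset.sum_congr rfl fun k _ => ?_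
    simp only [mul_apply_eq_comp]
    rw [← hC, ← hJ, ← hC]
  have e3 : ∑ i, (endTrace m (J * C (J (stdVec i)) * C (dualVec (g x) i))
      + endTrace m (C (J (stdVec i)) * J * C (dualVec (g x) i))) = 0 :=
    Finset.sum_eq_zero fun i _ => h1 _ _
  rw [Finset.sum_add_distrib, Finset.sum_congr rfl fun i _ => e2 i, ← e1] at e3
  rw [Finset.sum_congr rfl fun i _ => h0 _ _]
  linarith

/-! ### Covariant derivatives of J and n: the derivative of A is null somewhere -/

section CovEnd

variable {m : ℕ} {g : Coord m → Form m} {S T : Coord m → Coord m →L[ℝ] Coord m} {x : Coord m}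

theorem covEnd_mul (hS : DifferentiableAt ℝ S x) (hT : DifferentiableAt ℝ T x) (u : Coord m) :
    covEnd g (fun t => S t * T t) x u = covEnd g S x u * T x + S x * covEnd g T x u := by
  have h := (hS.hasFDerivAt.clm_comp hT.hasFDerivAt).fderiv
  have h' : fderiv ℝ (fun t => S t * T t) x = _ := h
  simp only [covEnd, h', ← ContinuousLinearMap.mul_def, add_apply, add_mul, mul_add, sub_mul,
    mul_sub, mul_assoc]
  simp [← ContinuousLinearMap.mul_def]
  abel

theorem covEnd_add (hS : DifferentiableAt ℝ S x) (hT : DifferentiableAt ℝ T x) (u : Coord m) :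
    covEnd g (fun t => S t + T t) x u = covEnd g S x u + covEnd g T x u := by
  simp only [covEnd, fderiv_fun_add hS hT, ← ContinuousLinearMap.mul_def, add_apply, add_mul,
    mul_add]
  abel

theorem covEnd_const_smul (hS : DifferentiableAt ℝ S x) (b : ℝ) (u : Coord m) :
    covEnd g (fun t => b • S t) x u = b • covEnd g S x u := by
  simp only [covEnd, fderiv_fun_const_smul hS, ← ContinuousLinearMap.mul_def, smul_apply,
    mul_smul_comm, smul_mul_assoc, smul_add, smul_sub]

/-- Constant multiples of the identity are parallel; this differentiates the relations J² = -1 and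
n² = 0. -/
theorem covEnd_smul_one (a : ℝ) (u : Coord m) :
    covEnd g (fun _ => a • (1 : Coord m →L[ℝ] Coord m)) x u = 0 := by
  simp [covEnd, ← ContinuousLinearMap.mul_def]

theorem covEnd_congr (h : S =ᶠ[nhds x] T) (u : Coord m) : covEnd g S x u = covEnd g T x u := by
  rw [covEnd, covEnd, h.fderiv_eq, h.eq_of_nhds]

end CovEnd

/-- A self-adjoint Codazzi field in dimension four with constant eigenvalues `a ± ib` has a
derivative which is a null tensor at some point. -/
theorem IsMetricOn.exists_sum_covEnd_eq_zero {g : Coord 4 → Form 4} {U : Set (Coord 4)}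
    (hg : IsMetricOn g U) (hU : U.Nonempty) {A : Coord 4 → Coord 4 →L[ℝ] Coord 4}
    (hA : ∀ x ∈ U, DifferentiableAt ℝ A x)
    (hs : ∀ x ∈ U, ∀ v w, g x (A x v) w = g x v (A x w))
    (hcod : ∀ x ∈ U, ∀ u v, covEnd g A x u v = covEnd g A x v u) {a b : ℝ} (hb : b ≠ 0)
    (hQ : ∀ x ∈ U, ((A x - a • 1) * (A x - a • 1) + b ^ 2 • (1 : Coord 4 →L[ℝ] Coord 4))
      * ((A x - a • 1) * (A x - a • 1) + b ^ 2 • (1 : Coord 4 →L[ℝ] Coord 4)) = 0) :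
    ∃ x ∈ U, ∑ i, endTrace 4 (covEnd g A x (stdVec i) * covEnd g A x (dualVec (g x) i)) = 0 := by
  set J : Coord 4 → Coord 4 →L[ℝ] Coord 4 := fun x => complexPart b (A x - a • 1) with hJdef
  set n : Coord 4 → Coord 4 →L[ℝ] Coord 4 := fun x => nilPart b (A x - a • 1) with hndef
  have hJJ : ∀ x ∈ U, J x * J x = -1 := fun x hx => complexPart_mul_self hb (hQ x hx)
  have hnn : ∀ x ∈ U, n x * n x = 0 := fun x hx => nilPart_mul_self hb (hQ x hx)
  have hJn : ∀ x, J x * n x = n x * J x := fun x => complexPart_mul_nilPart b _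
  have hsum : ∀ x, A x = (a • 1 + b • J x) + n x := fun x => by
    simp only [hndef, hJdef, nilPart]; abel
  have hSs : ∀ x ∈ U, ∀ v w, g x ((A x - a • 1) v) w = g x v ((A x - a • 1) w) := by
    intro x hx v w
    simp [hs x hx]
  have hJs : ∀ x ∈ U, ∀ v w, g x (J x v) w = g x v (J x w) := by
    intro x hx v w
    simp only [hJdef, complexPart, smul_apply, add_apply, map_smul, map_add,
      mul_apply_eq_comp, one_apply_eq_self, hSs x hx]
  have hns : ∀ x ∈ U, ∀ v w, g x (n x v) w = g x v (n x w) := by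
    intro x hx v w
    have e : n x = (A x - a • 1) - b • J x := rfl
    have h1 := hSs x hx v w
    rw [e]
    simp only [sub_apply, smul_apply, map_sub, map_smul, hJs x hx] at h1 ⊢
    linarith
  have hSd : ∀ x ∈ U, DifferentiableAt ℝ (fun t => A t - a • (1 : Coord 4 →L[ℝ] Coord 4)) x :=
    fun x hx => (hA x hx).sub_const _
  have hJd : ∀ x ∈ U, DifferentiableAt ℝ J x := by
    intro x hx
    have h := hSd x hx
    exact (h.fun_add ((h.fun_mul ((h.fun_mul h).add_const _)).fun_const_smul _)).fun_const_smul _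
  have hnd : ∀ x ∈ U, DifferentiableAt ℝ n x := fun x hx =>
    (hSd x hx).fun_sub ((hJd x hx).fun_const_smul b)
  clear_value J n
  -- The bare condition `n x = 0` would not suffice: in the second case ∇n must vanish at `x`, so
  -- `n` has to vanish on a neighbourhood.
  have hpart : ∀ x ∈ U, (n x ≠ 0 ∨ n =ᶠ[nhds x] fun _ => 0) → ∀ u v,
      (covEnd g A x u - J x * covEnd g A x u * J x)
        * (covEnd g A x v - J x * covEnd g A x v * J x) = 0 := by
    intro x hx hor u v
    have hUx := hg.isOpen.mem_nhds hx
    have c1 : ∀ u, covEnd g A x u = b • covEnd g J x u + covEnd g n x u := by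
      intro u
      have e : covEnd g A x u = covEnd g (fun t => (a • 1 + b • J t) + n t) x u := by
        congr 1; exact funext hsum
      rw [e, covEnd_add (((hJd x hx).fun_const_smul b).const_add (a • 1)) (hnd x hx),
        covEnd_add (differentiableAt_const _) ((hJd x hx).fun_const_smul b), covEnd_smul_one,
        covEnd_const_smul (hJd x hx), zero_add]
    have c2 : ∀ u, covEnd g J x u * J x + J x * covEnd g J x u = 0 := by
      intro u
      rw [← covEnd_mul (hJd x hx) (hJd x hx)]
      have : (fun t => J t * J t) =ᶠ[nhds x] fun _ => (-1 : ℝ) • 1 := by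
        filter_upwards [hUx] with t ht
        rw [hJJ t ht]; simp
      rw [covEnd_congr this, covEnd_smul_one]
    have c3 : ∀ u, covEnd g n x u * n x + n x * covEnd g n x u = 0 := by
      intro u
      rw [← covEnd_mul (hnd x hx) (hnd x hx)]
      have : (fun t => n t * n t) =ᶠ[nhds x] fun _ => (0 : ℝ) • 1 := by
        filter_upwards [hUx] with t ht
        rw [hnn t ht]; simp
      rw [covEnd_congr this, covEnd_smul_one]
    have c4 : ∀ u, covEnd g A x u - J x * covEnd g A x u * J x
        = covEnd g n x u - J x * covEnd g n x u * J x := fun u => by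
      rw [c1]; exact (commutingPart_anticomm (b := b) (CJ := covEnd g J x u)
        (Cn := covEnd g n x u) (hJJ x hx) (hJn x) (c2 u) (c3 u)).1
    have c5 : ∀ u, (covEnd g A x u - J x * covEnd g A x u * J x) * n x
        = -(n x * (covEnd g A x u - J x * covEnd g A x u * J x)) := fun u => by
      rw [c4]
      exact (commutingPart_anticomm (b := b) (CJ := covEnd g J x u)
        (Cn := covEnd g n x u) (hJJ x hx) (hJn x) (c2 u) (c3 u)).2
    have c6 : ∀ u v w, g x ((covEnd g A x u - J x * covEnd g A x u * J x) v) w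
        = g x v ((covEnd g A x u - J x * covEnd g A x u * J x) w) := fun u v w => by
      simp only [sub_apply, map_sub, mul_apply_eq_comp, hJs x hx,
        hg.covEnd_symm hx (hA x hx) hs]
    rcases hor with h0 | h0
    · exact mul_eq_zero_of_anticomm (hg.symm x hx) (hg.nondegenerate x hx) (hJJ x hx) (hnn x hx)
        (hJn x) h0 (hJs x hx) (hns x hx) (c6 u) (c6 v) (commutingPart_comm (hJJ x hx))
        (commutingPart_comm (hJJ x hx)) (c5 u) (c5 v)
    · have : covEnd g n x u = 0 := by
        have h0' : n =ᶠ[nhds x] fun _ => (0 : ℝ) • 1 := by simpa using h0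
        rw [covEnd_congr h0', covEnd_smul_one]
      rw [c4 u, this]; simp
  -- Either `n` is nonzero at some point, which is then chosen, or it vanishes on the open set U and
  -- any point will do. This choice is why the conclusion concerns a single point.
  obtain ⟨x, hx, hor⟩ : ∃ x ∈ U, n x ≠ 0 ∨ n =ᶠ[nhds x] fun _ => 0 := by
    by_cases h : ∃ x ∈ U, n x ≠ 0
    · obtain ⟨x, hx, h⟩ := h
      exact ⟨x, hx, Or.inl h⟩
    · push Not at h
      obtain ⟨x, hx⟩ := hU
      exact ⟨x, hx, Or.inr (by filter_upwards [hg.isOpen.mem_nhds hx] with t ht using h t ht)⟩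
  refine ⟨x, hx, hg.sum_endTrace_mul_eq_zero hx (hJs x hx)
    (fun u v w => hg.covEnd_symm hx (hA x hx) hs u v w) (hcod x hx)
    (fun u v => (endTrace_commutingPart (hJJ x hx) (hpart x hx hor u v)).1)
    (fun u v => (endTrace_commutingPart (hJJ x hx) (hpart x hx hor u v)).2)⟩

/-! ### Ricci identity for endomorphism fields and the Simons identity -/

namespace IsMetricOn

variable {m : ℕ} {g : Coord m → Form m} {U : Set (Coord m)} {x : Coord m}
  {A : Coord m → Coord m →L[ℝ] Coord m}

theorem differentiableAt_covEnd (hg : IsMetricOn g U) (hx : x ∈ U) (hA : ContDiffAt ℝ 2 A x)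
    (u : Coord m) : DifferentiableAt ℝ (fun t => covEnd g A t u) x := by
  have hA1 : DifferentiableAt ℝ A x := hA.differentiableAt (by simp)
  have hΓ : DifferentiableAt ℝ (fun t => christoffel g t u) x :=
    (hg.differentiableAt_christoffel hx).clm_apply (differentiableAt_const u)
  exact ((fderiv_fderiv_apply hA u).differentiableAt.fun_add (hΓ.clm_comp hA1)).fun_sub
    (hA1.clm_comp hΓ)

/-- The Ricci identity for fields of endomorphisms. -/
theorem covEnd_comm (hg : IsMetricOn g U) (hx : x ∈ U) (hA : ContDiffAt ℝ 2 A x)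
    (u v w : Coord m) :
    covEnd g (fun t => covEnd g A t v) x u w - covEnd g (fun t => covEnd g A t u) x v w
      = curvature g x u v (A x w) - A x (curvature g x u v w) := by
  have hA1 : DifferentiableAt ℝ A x := hA.differentiableAt (by simp)
  have key : ∀ u v, fderiv ℝ (fun t => covEnd g A t v) x u w
      = fderiv ℝ (fderiv ℝ A) x u v w
        + (fderiv ℝ (christoffel g) x u v (A x w) + christoffel g x v (fderiv ℝ A x u w))
        - (fderiv ℝ A x u (christoffel g x v w) + A x (fderiv ℝ (christoffel g) x u v w)) := by
    intro u v
    have hΓ := (hg.differentiableAt_christoffel hx).hasFDerivAt.clm_apply (hasFDerivAt_const v x)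
    have h := (((fderiv_fderiv_apply hA v).add (hΓ.clm_comp hA1.hasFDerivAt)).sub
      (hA1.hasFDerivAt.clm_comp hΓ)).fderiv
    have h' : fderiv ℝ (fun t => covEnd g A t v) x = _ := h
    rw [h']
    simp
    abel
  simp only [covEnd, add_apply, sub_apply, ContinuousLinearMap.comp_apply] at key ⊢
  rw [key u v, key v u, fderiv_fderiv_symm hA v u, hg.curvature_eq hx, hg.curvature_eq hx]
  simp only [map_add, map_sub]
  abel

theorem sum_sum_eq_endTrace (hg : IsMetricOn g U) (hx : x ∈ U) (X Y : Coord m →L[ℝ] Coord m)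
    (hY : ∀ v w, g x (Y v) w = g x v (Y w)) :
    ∑ i, ∑ k, g x (X (stdVec i)) (stdVec k) * g x (dualVec (g x) k) (Y (dualVec (g x) i))
      = endTrace m (Y * X) := by
  rw [hg.endTrace_eq hx]
  refine Finset.sum_congr rfl fun i _ => ?_
  rw [hg.sum_stdVec_dualVec hx, ← hY, hg.symm x hx, mul_apply_eq_comp]

/-- The contracted Simons identity for a Codazzi field satisfying the Gauss equation, with constant
trace and constant square trace, whose derivative has vanishing squared length. -/
theorem simons (hg : IsMetricOn g U) (hA : ∀ t ∈ U, ContDiffAt ℝ 2 A t)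
    (hs : ∀ t ∈ U, ∀ v w, g t (A t v) w = g t v (A t w))
    (hcod : ∀ t ∈ U, ∀ u v, covEnd g A t u v = covEnd g A t v u)
    (hT1 : ∀ t ∈ U, fderiv ℝ (fun s => endTrace m (A s)) t = 0)
    (hT2 : ∀ t ∈ U, fderiv ℝ (fun s => endTrace m (A s * A s)) t = 0)
    (hx : x ∈ U) {c k : ℝ}
    (hgauss : ∀ u v w, curvature g x u v w = c • (g x v w • u - g x u w • v)
      + k • (g x (A x v) w • A x u - g x (A x u) w • A x v))
    (h0 : ∑ i, endTrace m (covEnd g A x (stdVec i) * covEnd g A x (dualVec (g x) i)) = 0) :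
    c * (m * endTrace m (A x * A x) - endTrace m (A x) ^ 2)
      + k * (endTrace m (A x) * endTrace m (A x * A x * A x) - endTrace m (A x * A x) ^ 2)
      = 0 := by
  have hsym := hg.symm x hx
  have hUx := hg.isOpen.mem_nhds hx
  have hAd : ∀ t ∈ U, DifferentiableAt ℝ A t := fun t ht => (hA t ht).differentiableAt (by simp)
  have hCd : ∀ u, DifferentiableAt ℝ (fun t => covEnd g A t u) x :=
    hg.differentiableAt_covEnd hx (hA x hx)
  have hCs : ∀ t ∈ U, ∀ u v w, g t (covEnd g A t u v) w = g t v (covEnd g A t u w) :=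
    fun t ht => hg.covEnd_symm ht (hAd t ht) hs
  have hC1 : ∀ t ∈ U, ∀ u, endTrace m (covEnd g A t u) = 0 := fun t ht u => by
    rw [endTrace_covEnd (hAd t ht), hT1 t ht]; rfl
  have hC2 : ∀ t ∈ U, ∀ u, endTrace m (A t * covEnd g A t u) = 0 := fun t ht u => by
    have e := endTrace_covEnd (g := g) ((hAd t ht).fun_mul (hAd t ht)) u
    rw [covEnd_mul (hAd t ht) (hAd t ht), hT2 t ht, map_add, endTrace_mul_comm _ (A t)] at e
    simp only [zero_apply] at e
    linarith
  set D : Coord m → Coord m → Coord m →L[ℝ] Coord m :=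
    fun v u => covEnd g (fun t => covEnd g A t u) x v with hD
  -- `N v u` is the tensorial second derivative ∇²_{v,u} A.
  set N : Coord m → Coord m → Coord m →L[ℝ] Coord m :=
    fun v u => D v u - covEnd g A x (christoffel g x v u) with hN
  have hNs : ∀ v u y z, g x (N v u y) z = g x y (N v u z) := by
    intro v u y z
    have e1 := hg.covEnd_symm hx (hCd u) (fun t ht => hCs t ht u) v y z
    have e2 := hCs x hx (christoffel g x v u) y z
    simp only [hN, hD, sub_apply, map_sub, e1, e2]
  have hNt : ∀ v u, endTrace m (N v u) = 0 := by
    intro v u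
    have e : (fun t => endTrace m (covEnd g A t u)) =ᶠ[nhds x] fun _ => 0 := by
      filter_upwards [hUx] with t ht using hC1 t ht u
    simp only [hN, hD, map_sub, hC1 x hx, endTrace_covEnd (hCd u), e.fderiv_eq]
    simp
  -- Differentiate tr(A ∇_u A) = 0, which holds because tr A² is constant.
  have hNA : ∀ v u, endTrace m (A x * N v u)
      = -endTrace m (covEnd g A x v * covEnd g A x u) := by
    intro v u
    have e : (fun t => endTrace m (A t * covEnd g A t u)) =ᶠ[nhds x] fun _ => 0 := by
      filter_upwards [hUx] with t ht using hC2 t ht u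
    have e1 := endTrace_covEnd (g := g) ((hAd x hx).fun_mul (hCd u)) v
    rw [covEnd_mul (hAd x hx) (hCd u), e.fderiv_eq, map_add] at e1
    simp only [fderiv_const_apply, zero_apply] at e1
    simp only [hN, hD, mul_sub, map_sub, hC2 x hx]
    linarith
  have hNc : ∀ v u w, N v u w = N v w u := by
    intro v u w
    have e : (fun t => covEnd g A t u w) =ᶠ[nhds x] fun t => covEnd g A t w u := by
      filter_upwards [hUx] with t ht using hcod t ht u w
    have e1 := covDerivAlong_congr (G := g) (φ := id) e v
    rw [covDerivAlong_end_apply (hCd u), covDerivAlong_end_apply (hCd w),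
      hcod x hx u, hcod x hx w] at e1
    simp only [hN, hD, sub_apply]
    rw [sub_eq_sub_iff_add_eq_add, e1]
  have hNR : ∀ u v w, N u v w = N v u w + (curvature g x u v (A x w)
      - A x (curvature g x u v w)) := by
    intro u v w
    rw [← hg.covEnd_comm hx (hA x hx)]
    simp only [hN, hD, sub_apply, hg.christoffel_symm hx u v]
    abel
  have hsA := hs x hx
  have hsA2 : ∀ v w, g x ((A x * A x) v) w = g x v ((A x * A x) w) := fun v w => by
    simp only [mul_apply_eq_comp, hsA]
  have hsA3 : ∀ v w, g x ((A x * A x * A x) v) w = g x v ((A x * A x * A x) w) := fun v w => by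
    simp only [mul_apply_eq_comp, hsA]
  -- The trace of A against the Laplacian of A is minus the squared length of ∇A, hence zero.
  -- Codazzi and Ricci move the contracted indices onto A itself: one term is the second derivative
  -- of tr A, which vanishes by `first`, and the others are curvature terms.
  have main : ∑ i, ∑ j, (g x (N (stdVec j) (A x (dualVec (g x) j)) (dualVec (g x) i)) (stdVec i)
      + g x (A x (dualVec (g x) j)) (curvature g x (dualVec (g x) i) (stdVec j)
          (A x (stdVec i)) - A x (curvature g x (dualVec (g x) i) (stdVec j) (stdVec i)))) = 0 := by
    have e : ∑ i, endTrace m (A x * N (dualVec (g x) i) (stdVec i)) = 0 := by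
      simp only [hNA, Finset.sum_neg_distrib]
      rw [neg_eq_zero, ← h0]
      exact Finset.sum_congr rfl fun i _ => endTrace_mul_comm _ _
    rw [← e]
    refine Finset.sum_congr rfl fun i _ => ?_
    rw [hg.endTrace_eq hx]
    refine Finset.sum_congr rfl fun j _ => ?_
    have f1 : N (dualVec (g x) i) (stdVec i) (stdVec j)
        = N (stdVec j) (dualVec (g x) i) (stdVec i)
          + (curvature g x (dualVec (g x) i) (stdVec j) (A x (stdVec i))
            - A x (curvature g x (dualVec (g x) i) (stdVec j) (stdVec i))) := by
      rw [hNc _ (stdVec i) (stdVec j), hNR (dualVec (g x) i) (stdVec j) (stdVec i)]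
    have f2 : g x (N (stdVec j) (A x (dualVec (g x) j)) (dualVec (g x) i)) (stdVec i)
        = g x (A x (dualVec (g x) j)) (N (stdVec j) (dualVec (g x) i) (stdVec i)) := by
      rw [hNc (stdVec j) (A x _) (dualVec (g x) i), hNs]
    rw [mul_apply_eq_comp, ← hsA, f1, f2, map_add]
  have first : ∑ i, ∑ j, g x (N (stdVec j) (A x (dualVec (g x) j)) (dualVec (g x) i)) (stdVec i)
      = 0 := by
    rw [Finset.sum_comm]
    exact Finset.sum_eq_zero fun j _ => by rw [← hg.endTrace_eq' hx, hNt]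
  -- By the Gauss equation each curvature term is a difference of two contractions of powers of A.
  -- The contributions with tr A⁴ cancel on summation.
  have expand : ∀ i j : Fin m, g x (A x (dualVec (g x) j)) (curvature g x (dualVec (g x) i)
        (stdVec j) (A x (stdVec i)) - A x (curvature g x (dualVec (g x) i) (stdVec j) (stdVec i)))
      = c * (g x (A x (stdVec i)) (stdVec j) * g x (dualVec (g x) j) (A x (dualVec (g x) i))
          - g x (dualVec (g x) i) (A x (stdVec i)) * g x (dualVec (g x) j) (A x (stdVec j)))
        + k * (g x ((A x * A x) (stdVec i)) (stdVec j)
            * g x (dualVec (g x) j) ((A x * A x) (dualVec (g x) i))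
          - g x (dualVec (g x) i) ((A x * A x) (stdVec i))
            * g x (dualVec (g x) j) ((A x * A x) (stdVec j)))
        - c * (g x ((1 : Coord m →L[ℝ] Coord m) (stdVec i)) (stdVec j)
            * g x (dualVec (g x) j) ((A x * A x) (dualVec (g x) i))
          - g x (dualVec (g x) i) ((1 : Coord m →L[ℝ] Coord m) (stdVec i))
            * g x (dualVec (g x) j) ((A x * A x) (stdVec j)))
        - k * (g x (A x (stdVec i)) (stdVec j)
            * g x (dualVec (g x) j) ((A x * A x * A x) (dualVec (g x) i))
          - g x (dualVec (g x) i) (A x (stdVec i))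
            * g x (dualVec (g x) j) ((A x * A x * A x) (stdVec j))) := by
    intro i j
    simp only [hgauss, map_sub, map_add, map_smul, smul_eq_mul, mul_apply_eq_comp,
      one_apply_eq_self, hsA]
    rw [hsym (stdVec j) (A x (stdVec i)), hsA (stdVec i) (stdVec j),
      hsym (stdVec j) (A x (A x (stdVec i))), hsA (A x (stdVec i)) (stdVec j),
      hsA (stdVec i) (A x (stdVec j)), hsym (stdVec j) (stdVec i)]
    ring
  simp only [Finset.sum_add_distrib, first, zero_add, expand, Finset.sum_sub_distrib,
    ← Finset.mul_sum, ← Finset.sum_mul, ← hg.endTrace_eq hx,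
    hg.sum_sum_eq_endTrace hx _ _ hsA, hg.sum_sum_eq_endTrace hx _ _ hsA2,
    hg.sum_sum_eq_endTrace hx _ _ hsA3] at main
  have e1 : endTrace m (1 : Coord m →L[ℝ] Coord m) = m := by
    rw [endTrace_apply]
    have := LinearMap.trace_one ℝ (Coord m)
    rw [finrank_euclideanSpace_fin] at this
    exact this
  rw [e1] at main
  simp only [mul_one, mul_assoc] at main ⊢
  linarith

end IsMetricOn

/-! ### Operators on ℝ⁴ with exactly two eigenvalues, both imaginary -/

open Polynomial in
/-- A real monic quartic with exactly two complex roots, both not real, is the square of a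
quadratic polynomial. -/
theorem eq_sq_of_two_imaginary_roots {p : ℝ[X]} (hp : p.Monic) (hdeg : p.natDegree = 4)
    (hcard : {z : ℂ | (p.map (algebraMap ℝ ℂ)).IsRoot z}.ncard = 2)
    (him : ∀ z ∈ {z : ℂ | (p.map (algebraMap ℝ ℂ)).IsRoot z}, z.im ≠ 0) :
    ∃ a b : ℝ, b ≠ 0 ∧ p = ((X - C a) ^ 2 + C (b ^ 2)) ^ 2 := by
  have hroot : ∀ (q : ℝ[X]) (z : ℂ), aeval z q = 0 ↔ (q.map (algebraMap ℝ ℂ)).IsRoot z := by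
    intro q z; rw [IsRoot.def, eval_map_algebraMap]
  obtain ⟨z, w, -, hS⟩ := Set.ncard_eq_two.1 hcard
  have hz : z ∈ {z : ℂ | (p.map (algebraMap ℝ ℂ)).IsRoot z} := by rw [hS]; simp
  have hzi := him z hz
  have hz0 : aeval z p = 0 := (hroot p z).2 hz
  have hzc : (starRingEnd ℂ) z ∈ {z : ℂ | (p.map (algebraMap ℝ ℂ)).IsRoot z} := by
    refine (hroot p _).1 ?_
    rw [aeval_conj, hz0, map_zero]
  have hne : (starRingEnd ℂ) z ≠ z := fun h => hzi (Complex.conj_eq_iff_im.1 h)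
  -- The roots of a real polynomial are closed under conjugation, so two non-real roots are a
  -- conjugate pair.
  have hS' : ∀ v, aeval v p = 0 → v = z ∨ v = (starRingEnd ℂ) z := by
    intro v hv
    have h1 : v ∈ ({z, w} : Set ℂ) := by rw [← hS]; exact (hroot p v).1 hv
    rw [hS] at hzc
    rcases hzc with h2 | h2
    · exact absurd h2 hne
    · rcases h1 with h1 | h1
      · exact Or.inl h1
      · rw [Set.mem_singleton_iff] at h1 h2
        exact Or.inr (h1.trans h2.symm)
  set q : ℝ[X] := (X - C z.re) ^ 2 + C (z.im ^ 2) with hq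
  have hdvd : ∀ r : ℝ[X], (∃ v, (v = z ∨ v = (starRingEnd ℂ) z) ∧ aeval v r = 0) → q ∣ r := by
    rintro r ⟨v, hv, hr⟩
    have hvi : v.im ≠ 0 := by rcases hv with rfl | rfl <;> simpa using hzi
    have h := quadratic_dvd_of_aeval_eq_zero_im_ne_zero r hr hvi
    have e : X ^ 2 - C (2 * v.re) * X + C (‖v‖ ^ 2) = q := by
      have e1 : ‖v‖ ^ 2 = z.re ^ 2 + z.im ^ 2 := by
        rw [← Complex.normSq_eq_norm_sq, Complex.normSq_apply]
        rcases hv with rfl | rfl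
        · ring
        · simp; ring
      have e2 : v.re = z.re := by rcases hv with rfl | rfl <;> simp
      rw [e1, e2, hq]
      simp only [C_add, C_mul, C_pow]
      have : (C 2 : ℝ[X]) = 2 := rfl
      rw [this]; ring
    rwa [e] at h
  have hqm : q.Monic := by
    rw [hq]; monicity!
  have hqd : q.natDegree = 2 := by
    rw [hq]; compute_degree!
  obtain ⟨r, hr⟩ := hdvd p ⟨z, Or.inl rfl, hz0⟩
  have hrm : r.Monic := hqm.of_mul_monic_left (hr ▸ hp)
  have hrd : r.natDegree = 2 := by
    have := hqm.natDegree_mul hrm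
    rw [← hr, hdeg, hqd] at this; omega
  -- The cofactor is a real quadratic whose roots are among those of `p`, so the same real quadratic
  -- divides it and degrees leave nothing else.
  obtain ⟨v, hv⟩ := IsAlgClosed.exists_aeval_eq_zero ℂ r (by
    rw [degree_eq_natDegree hrm.ne_zero, hrd]; norm_num)
  obtain ⟨s, hs⟩ := hdvd r ⟨v, hS' v (by rw [hr, map_mul, hv, mul_zero]), hv⟩
  have hsm : s.Monic := hqm.of_mul_monic_left (hs ▸ hrm)
  have hsd : s.natDegree = 0 := by
    have := hqm.natDegree_mul hsm
    rw [← hs, hrd, hqd] at this; omega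
  have hs1 : s = 1 := Polynomial.eq_one_of_monic_natDegree_zero hsm hsd
  exact ⟨z.re, z.im, hzi, by rw [hr, hs, hs1, ← hq]; ring⟩

/-- The operator form of the condition on the principal curvatures. -/
theorem exists_of_two_imaginary_roots {L : Coord 4 →L[ℝ] Coord 4}
    (hcard : {z : ℂ | (((L : Coord 4 →ₗ[ℝ] Coord 4).charpoly).map
      (algebraMap ℝ ℂ)).IsRoot z}.ncard = 2)
    (him : ∀ z ∈ {z : ℂ | (((L : Coord 4 →ₗ[ℝ] Coord 4).charpoly).map
      (algebraMap ℝ ℂ)).IsRoot z}, z.im ≠ 0) :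
    ∃ a b : ℝ, b ≠ 0 ∧ endTrace 4 L = 4 * a ∧
      ((L - a • 1) * (L - a • 1) + b ^ 2 • (1 : Coord 4 →L[ℝ] Coord 4))
        * ((L - a • 1) * (L - a • 1) + b ^ 2 • (1 : Coord 4 →L[ℝ] Coord 4)) = 0 := by
  open Polynomial in
  set T : Module.End ℝ (Coord 4) := (L : Coord 4 →ₗ[ℝ] Coord 4) with hT
  obtain ⟨a, b, hb, hp⟩ := eq_sq_of_two_imaginary_roots (LinearMap.charpoly_monic T)
    (by rw [LinearMap.charpoly_natDegree, finrank_euclideanSpace_fin]) hcard him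
  refine ⟨a, b, hb, ?_, ?_⟩
  · have h1 : LinearMap.trace ℝ (Coord 4) T = -T.charpoly.nextCoeff := by
      have B := (EuclideanSpace.basisFun (Fin 4) ℝ).toBasis
      rw [← LinearMap.charpoly_toMatrix T B, LinearMap.trace_eq_matrix_trace ℝ B,
        Matrix.trace_eq_neg_charpoly_nextCoeff]
    have hqm : ((X - C a) ^ 2 + C (b ^ 2) : ℝ[X]).Monic := by monicity!
    have hqd : ((X - C a) ^ 2 + C (b ^ 2) : ℝ[X]).natDegree = 2 := by compute_degree!
    rw [endTrace_apply, ← hT, h1, hp, hqm.nextCoeff_pow, nextCoeff_of_natDegree_pos (by omega),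
      hqd]
    have : ((X - C a) ^ 2 + C (b ^ 2) : ℝ[X]) = X ^ 2 - C (2 * a) * X + C (a ^ 2 + b ^ 2) := by
      simp only [C_add, C_mul, C_pow]
      have : (C 2 : ℝ[X]) = 2 := rfl
      rw [this]; ring
    rw [this]
    simp only [coeff_add, coeff_sub, coeff_X_pow, coeff_C_mul, coeff_X, coeff_C]
    norm_num
    ring
  · have h := LinearMap.aeval_self_charpoly T
    rw [hp] at h
    ext1 v
    have h' := congrArg (fun S : Module.End ℝ (Coord 4) => S v) h
    simpa [hT, pow_two, mul_smul] using h'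

section Scaling

variable {R : Type*} [Ring R] [Algebra ℝ R]

/-- Rescaling the normal vector rescales the eigenvalues a ± ib; this passes from the unit normal to
τ. -/
theorem quartic_smul {L : R} {a b : ℝ} (s : ℝ)
    (h : ((L - a • 1) * (L - a • 1) + b ^ 2 • (1 : R))
      * ((L - a • 1) * (L - a • 1) + b ^ 2 • (1 : R)) = 0) :
    ((s • L - (s * a) • 1) * (s • L - (s * a) • 1) + (s * b) ^ 2 • (1 : R))
      * ((s • L - (s * a) • 1) * (s • L - (s * a) • 1) + (s * b) ^ 2 • (1 : R)) = 0 := by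
  have e : (s • L - (s * a) • 1) * (s • L - (s * a) • 1) + (s * b) ^ 2 • (1 : R)
      = s ^ 2 • ((L - a • 1) * (L - a • 1) + b ^ 2 • (1 : R)) := by
    rw [mul_smul, ← smul_sub, smul_mul_smul_comm]
    module
  rw [e, smul_mul_smul_comm, h, smul_zero]

end Scaling

/-- On an eigenvector with real eigenvalue μ the annihilating polynomial acts by ((μ - a)² + b²)²,
which is positive. -/
theorem eq_zero_of_apply_eq_smul {n : ℕ} {A : Coord n →L[ℝ] Coord n} {a b : ℝ} (hb : b ≠ 0)
    (h : ((A - a • 1) * (A - a • 1) + b ^ 2 • (1 : Coord n →L[ℝ] Coord n))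
      * ((A - a • 1) * (A - a • 1) + b ^ 2 • (1 : Coord n →L[ℝ] Coord n)) = 0)
    {μ : ℝ} {v : Coord n} (hv : A v = μ • v) : v = 0 := by
  have e := congrArg (fun T : Coord n →L[ℝ] Coord n => T v) h
  simp only [mul_apply_eq_comp, add_apply, sub_apply, smul_apply, one_apply_eq_self, hv,
    map_add, map_sub, map_smul, zero_apply] at e
  have e' : ((μ - a) ^ 2 + b ^ 2) ^ 2 • v = 0 := by
    rw [← e]; module
  exact (smul_eq_zero.1 e').resolve_left (by positivity)

/-- Traces of powers of an operator with characteristic polynomial `((X - a)² + b²)²`. -/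
theorem endTrace_powers {A : Coord 4 →L[ℝ] Coord 4} {a b : ℝ} (hb : b ≠ 0)
    (htr : endTrace 4 A = 4 * a)
    (h : ((A - a • 1) * (A - a • 1) + b ^ 2 • (1 : Coord 4 →L[ℝ] Coord 4))
      * ((A - a • 1) * (A - a • 1) + b ^ 2 • (1 : Coord 4 →L[ℝ] Coord 4)) = 0) :
    endTrace 4 (A * A) = 4 * (a ^ 2 - b ^ 2) ∧
    endTrace 4 (A * A * A) = 4 * (a ^ 3 - 3 * a * b ^ 2) := by
  obtain ⟨J, hJ⟩ : ∃ J, J = complexPart b (A - a • 1) := ⟨_, rfl⟩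
  obtain ⟨n, hn⟩ : ∃ n, n = nilPart b (A - a • 1) := ⟨_, rfl⟩
  have hJJ : J * J = -1 := hJ ▸ complexPart_mul_self hb h
  have hnn : n * n = 0 := hn ▸ nilPart_mul_self hb h
  have hnJ : n * J = J * n := by rw [hJ, hn]; exact (complexPart_mul_nilPart b _).symm
  have hsum : A = a • 1 + b • J + n := by
    rw [hn, nilPart, ← hJ]; abel
  have nil : ∀ T : Coord 4 →L[ℝ] Coord 4, T * T = 0 → endTrace 4 T = 0 := by
    intro T hT
    have hnil : IsNilpotent (T : Coord 4 →ₗ[ℝ] Coord 4) := by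
      refine ⟨2, ?_⟩
      rw [pow_two]
      ext1 v
      have := congrArg (fun S : Coord 4 →L[ℝ] Coord 4 => S v) hT
      simpa using this
    exact (LinearMap.isNilpotent_trace_of_isNilpotent hnil).eq_zero
  have t1 : endTrace 4 (1 : Coord 4 →L[ℝ] Coord 4) = 4 := by
    rw [endTrace_apply]
    have := LinearMap.trace_one ℝ (Coord 4)
    rw [finrank_euclideanSpace_fin] at this
    exact_mod_cast this
  have tn : endTrace 4 n = 0 := nil n hnn
  have h1 : ∀ X, J * (J * X) = -X := fun X => by rw [← mul_assoc, hJJ, neg_one_mul]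
  have h2 : ∀ X, n * (n * X) = 0 := fun X => by rw [← mul_assoc, hnn, zero_mul]
  have h3 : ∀ X, n * (J * X) = J * (n * X) := fun X => by rw [← mul_assoc, hnJ, mul_assoc]
  have tJn : endTrace 4 (J * n) = 0 := nil _ (by
    rw [mul_assoc, h3, hnn]; simp)
  -- The nilpotent part is traceless and the identity contributes `4 a`, so b tr J = tr A - 4a = 0.
  have tJ : endTrace 4 J = 0 := by
    rw [hsum] at htr
    simp only [map_add, map_smul, t1, tn, smul_eq_mul] at htr
    have : b * endTrace 4 J = 0 := by linarith
    exact (mul_eq_zero.1 this).resolve_left hb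
  constructor
  · rw [hsum]
    simp only [mul_add, add_mul, smul_mul_assoc, mul_smul_comm, one_mul, mul_one, hJJ, hnn, hnJ,
      map_add, map_smul, t1, tn, tJ, tJn, smul_eq_mul, map_neg, map_zero, smul_add]
    ring
  · rw [hsum]
    simp only [mul_add, add_mul, smul_mul_assoc, mul_smul_comm, one_mul, mul_one, mul_assoc, hJJ,
      hnn, hnJ, h1, mul_neg, mul_zero, zero_mul, neg_mul, smul_zero,
      map_add, map_smul, t1, tn, tJ, tJn, smul_eq_mul, map_neg, map_zero, smul_add]
    ring

/-! ### The contradiction in coordinates -/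

namespace IsHypersurfaceOn

variable {g : Coord 4 → Form 4} {G : Coord 5 → Form 5}
  {φ : Coord 4 → Coord 5} {U : Set (Coord 4)} {V : Set (Coord 5)} {c : ℝ} {x : Coord 4}

/-- The principal curvature hypothesis concerns unit normals. The vector τ/√|κ| is one, its square
being the sign of κ, and A_τ is √|κ| times its shape operator. -/
theorem exists_tensionShape (h : IsHypersurfaceOn g G φ U V c) (hx : x ∈ U)
    (hκ : tensionSq g G φ x ≠ 0)
    (hpc : ∀ ξ, IsUnitNormal G φ x ξ → (principalCurvatures g G φ x ξ).ncard = 2 ∧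
      ∀ z ∈ principalCurvatures g G φ x ξ, z.im ≠ 0) :
    ∃ a b : ℝ, b ≠ 0 ∧ endTrace 4 (tensionShape g G φ x) = 4 * a ∧
      ((tensionShape g G φ x - a • 1) * (tensionShape g G φ x - a • 1)
          + b ^ 2 • (1 : Coord 4 →L[ℝ] Coord 4))
        * ((tensionShape g G φ x - a • 1) * (tensionShape g G φ x - a • 1)
          + b ^ 2 • (1 : Coord 4 →L[ℝ] Coord 4)) = 0 := by
  set r := √|tensionSq g G φ x| with hr
  have hr0 : r ≠ 0 := (Real.sqrt_pos.2 (abs_pos.2 hκ)).ne'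
  have hr2 : r * r = |tensionSq g G φ x| := Real.mul_self_sqrt (abs_nonneg _)
  have hξ : IsUnitNormal G φ x (r⁻¹ • tension g G φ x) := by
    constructor
    · intro u
      rw [map_smul, smul_apply, h.inner_tension_fderiv hx, smul_zero]
    · have e : G (φ x) (r⁻¹ • tension g G φ x) (r⁻¹ • tension g G φ x)
          = tensionSq g G φ x / |tensionSq g G φ x| := by
        rw [← hr2]
        simp only [map_smul, smul_apply, smul_eq_mul, tensionSq]
        field_simp
      rw [e]
      rcases abs_cases (tensionSq g G φ x) with ⟨h1, -⟩ | ⟨h1, -⟩ <;> rw [h1]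
      · left; exact div_self hκ
      · right; rw [div_neg, div_self hκ]
  obtain ⟨h1, h2⟩ := hpc _ hξ
  obtain ⟨a, b, hb, htr, hL⟩ := exists_of_two_imaginary_roots h1 h2
  have hA : tensionShape g G φ x = r • shapeOperator g G φ x (r⁻¹ • tension g G φ x) := by
    ext1 u
    refine h.left.ext_left hx fun v => ?_
    rw [h.inner_tensionShape hx, smul_apply, map_smul, smul_apply, shapeOperator_apply,
      h.left.apply_inverse hx, ContinuousLinearMap.comp_apply, map_smul, smul_apply, smul_smul,
      mul_inv_cancel₀ hr0, one_smul]
  refine ⟨r * a, r * b, mul_ne_zero hr0 hb, ?_, ?_⟩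
  · rw [hA, map_smul, htr, smul_eq_mul]; ring
  · rw [hA]; exact quartic_smul r hL

/-- The theorem in coordinates. -/
theorem tension_eq_zero (h : IsHypersurfaceOn g G φ U V c)
    (hbi : ∀ x ∈ U, bitension g G φ x = 0)
    (hpc : ∀ x ∈ U, ∀ ξ, IsUnitNormal G φ x ξ → (principalCurvatures g G φ x ξ).ncard = 2 ∧
      ∀ z ∈ principalCurvatures g G φ x ξ, z.im ≠ 0) (hx : x ∈ U) :
    tension g G φ x = 0 := by
  by_contra hτ
  have hκx := h.tensionSq_ne_zero hx hτ
  have hev : ∀ᶠ t in nhds x, t ∈ U ∧ tensionSq g G φ t ≠ 0 :=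
    (h.left.isOpen.eventually_mem hx).and
      ((h.contDiffAt_tensionSq hx).continuousAt.eventually_ne hκx)
  -- A ball is connected, so dκ = 0 will make κ constant on it.
  obtain ⟨ε, hε, hball⟩ := Metric.eventually_nhds_iff_ball.1 hev
  set W := Metric.ball x ε
  have hxW : x ∈ W := Metric.mem_ball_self hε
  have hW : IsHypersurfaceOn g G φ W V c := h.mono Metric.isOpen_ball fun t ht => (hball t ht).1
  have hκ : ∀ t ∈ W, tensionSq g G φ t ≠ 0 := fun t ht => (hball t ht).2
  have hbiW : ∀ t ∈ W, bitension g G φ t = 0 := fun t ht => hbi t (hball t ht).1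
  have hex := fun t (ht : t ∈ W) => hW.exists_tensionShape ht (hκ t ht) (hpc t (hball t ht).1)
  have hdκ : ∀ t ∈ W, fderiv ℝ (tensionSq g G φ) t = 0 := by
    intro t ht
    obtain ⟨a, b, hb, -, hQ⟩ := hex t ht
    exact hW.tensionLogDeriv_eq_zero hκ ht (hbiW t ht) fun μ v => eq_zero_of_apply_eq_smul hb hQ
  have hconst : ∀ t ∈ W, tensionSq g G φ t = tensionSq g G φ x := fun t ht =>
    Metric.isOpen_ball.is_const_of_fderiv_eq_zero (𝕜 := ℝ)
      (convex_ball x ε).isPreconnected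
      (fun s hs => ((hW.contDiffAt_tensionSq hs).differentiableAt
        (by simp)).differentiableWithinAt) hdκ ht hxW
  set A := tensionShape g G φ with hA
  set κ := tensionSq g G φ x with hκdef
  have hT1 : ∀ t ∈ W, endTrace 4 (A t) = κ := fun t ht => by
    rw [← hconst t ht]; exact hW.endTrace_tensionShape ht
  have hT2 : ∀ t ∈ W, endTrace 4 (A t * A t) = 4 * c * κ := fun t ht => by
    rw [← hconst t ht]; exact_mod_cast hW.endTrace_sq hκ ht (hbiW t ht) hdκ
  obtain ⟨a, -, -, htr, -⟩ := hex x hxW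
  have hκa : κ = 4 * a := by rw [← hT1 x hxW, htr]
  -- At each point `a` is fixed by tr A = κ and `b²` by tr A² = 4cκ. The sign of `b` is immaterial,
  -- since only `b²` enters the quartic relation, so one `b` serves the whole ball.
  have hQ' : ∀ t ∈ W, ∃ b, b ≠ 0 ∧ 4 * c * κ = 4 * (a ^ 2 - b ^ 2) ∧
      ((A t - a • 1) * (A t - a • 1) + b ^ 2 • (1 : Coord 4 →L[ℝ] Coord 4))
      * ((A t - a • 1) * (A t - a • 1) + b ^ 2 • (1 : Coord 4 →L[ℝ] Coord 4)) = 0 := by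
    intro t ht
    obtain ⟨a', b, hb, htr', hQ⟩ := hex t ht
    have : a' = a := by
      have := hT1 t ht
      rw [htr'] at this; linarith
    subst this
    exact ⟨b, hb, by rw [← hT2 t ht]; exact (endTrace_powers hb htr' hQ).1, hQ⟩
  obtain ⟨b, hb, hck, -⟩ := hQ' x hxW
  have hQ : ∀ t ∈ W, ((A t - a • 1) * (A t - a • 1) + b ^ 2 • (1 : Coord 4 →L[ℝ] Coord 4))
      * ((A t - a • 1) * (A t - a • 1) + b ^ 2 • (1 : Coord 4 →L[ℝ] Coord 4)) = 0 := by
    intro t ht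
    obtain ⟨b', -, h', hQt⟩ := hQ' t ht
    have hb2 : b' ^ 2 = b ^ 2 := by linarith
    rwa [hb2] at hQt
  -- With κ constant the correction term from the unnormalised normal field disappears from the
  -- Codazzi equation.
  have hcod : ∀ t ∈ W, ∀ u v, covEnd g A t u v = covEnd g A t v u := by
    intro t ht u v
    have e := hW.codazzi hκ ht u v
    simpa only [tensionLogDeriv, hdκ t ht, zero_apply, zero_div, zero_smul, add_zero] using e
  have hd0 : ∀ (f : Coord 4 → ℝ) (k : ℝ), (∀ t ∈ W, f t = k) → ∀ t ∈ W, fderiv ℝ f t = 0 := by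
    intro f k hf t ht
    have : f =ᶠ[nhds t] fun _ => k := by
      filter_upwards [Metric.isOpen_ball.mem_nhds ht] with s hs using hf s hs
    rw [this.fderiv_eq]; simp
  obtain ⟨y, hy, hnull⟩ := hW.left.exists_sum_covEnd_eq_zero ⟨x, hxW⟩
    (fun t ht => hW.differentiableAt_tensionShape ht) (fun t ht => hW.tensionShape_symm ht)
    hcod hb hQ
  have hsim := hW.left.simons
    (fun t ht => (hW.contDiffAt_tensionShape ht).of_le two_le_infty)
    (fun t ht => hW.tensionShape_symm ht) hcod (hd0 _ _ hT1) (hd0 _ _ hT2) hy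
    (fun u v w => hW.gauss hκ hy u v w) hnull
  have htr' : endTrace 4 (A y) = 4 * a := by rw [hT1 y hy, hκa]
  obtain ⟨p2, p3⟩ := endTrace_powers hb htr' (hQ y hy)
  rw [← hA, htr', p2, p3, hconst y hy] at hsim
  have ha : a ≠ 0 := by rintro rfl; exact hκx (by rw [hκa]; ring)
  have hκ0 : κ ≠ 0 := hκx
  field_simp at hsim
  -- The Simons identity reads -16b²(c + (a² + b²)/κ) = 0; inserting cκ = a² - b² leaves a²b² = 0.
  have hfin : a ^ 2 * b ^ 2 = 0 := by
    push_cast at hsim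
    nlinarith
  exact mul_ne_zero (pow_ne_zero 2 ha) (pow_ne_zero 2 hb) hfin

end IsHypersurfaceOn

/-! ### From the manifolds to charts -/

section Manifold

set_option linter.unusedSectionVars false

variable {m n : ℕ}
  {M : Type*} [TopologicalSpace M] [ChartedSpace (Coord m) M] [IsManifold (𝓡 m) ∞ M]
  {N : Type*} [TopologicalSpace N] [ChartedSpace (Coord n) N] [IsManifold (𝓡 n) ∞ N]

theorem mdifferentiable_of_mem_maximalAtlas {e : OpenPartialHomeomorph M (Coord m)}
    (he : e ∈ IsManifold.maximalAtlas (𝓡 m) ∞ M) : e.MDifferentiable (𝓡 m) (𝓡 m) :=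
  ⟨(contMDiffOn_of_mem_maximalAtlas he).mdifferentiableOn (by simp),
    (contMDiffOn_symm_of_mem_maximalAtlas he).mdifferentiableOn (by simp)⟩

/-- The expression of a smooth metric in a chart is a smooth metric. -/
theorem Metric.isMetricOn_inChart (g : Metric m M) {e : OpenPartialHomeomorph M (Coord m)}
    (he : e ∈ IsManifold.maximalAtlas (𝓡 m) ∞ M) : IsMetricOn (g.inChart e) e.target where
  isOpen := e.open_target
  contDiffOn := by
    -- The coordinate fields d(e⁻¹)u are smooth. Smoothness of the form-valued map is then tested on
    -- pairs of constant vectors.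
    have hvec : ∀ u : Coord m, ContMDiffOn (𝓡 m) (𝓡 m).tangent ∞
        (fun y => (⟨e.symm y, mfderiv (𝓡 m) (𝓡 m) e.symm y u⟩ : TangentBundle (𝓡 m) M))
        e.target := by
      intro u
      have h1 := (contMDiffOn_symm_of_mem_maximalAtlas he).contMDiffOn_tangentMapWithin
        (m := ∞) (by simp) e.open_target.uniqueMDiffOn
      have h2 : ContMDiffOn (𝓡 m) (𝓡 m).tangent ∞
          (fun y => (⟨y, u⟩ : TangentBundle (𝓡 m) (Coord m))) e.target :=
        contMDiffOn_vectorSpace_iff_contDiffOn.2 contDiffOn_const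
      refine (h1.comp h2 fun y hy => hy).congr fun y hy => ?_
      simp only [tangentMapWithin, Function.comp_apply]
      rw [mfderivWithin_of_mem_nhds (e.open_target.mem_nhds hy)]
    rw [contDiffOn_clm_apply]
    intro u
    rw [contDiffOn_clm_apply]
    intro v
    rw [← contMDiffOn_iff_contDiffOn]
    intro y hy
    have hg := (g.contMDiff (e.symm y)).comp_contMDiffWithinAt y
      (contMDiffOn_symm_of_mem_maximalAtlas he y hy)
    have h3 : ContMDiffWithinAt (𝓡 m) ((𝓡 m).prod 𝓘(ℝ)) ∞
        (fun y => Bundle.TotalSpace.mk' ℝ (E := Bundle.Trivial M ℝ) (e.symm y)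
          (g.inner (e.symm y) (mfderiv (𝓡 m) (𝓡 m) e.symm y u)
            (mfderiv (𝓡 m) (𝓡 m) e.symm y v))) e.target y := by
      apply ContMDiffWithinAt.clm_bundle_apply₂ (F₁ := Coord m) (F₂ := Coord m)
      · exact hg
      · exact hvec u y hy
      · exact hvec v y hy
    simp only [Bundle.contMDiffWithinAt_totalSpace] at h3
    exact h3.2
  symm y _ v w := g.symm _ _ _
  nondegenerate y hy v hv := by
    have hd := (mdifferentiable_of_mem_maximalAtlas he).symm
    have hsurj := hd.mfderiv_surjective hy
    have hinj := hd.mfderiv_injective hy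
    have h0 : mfderiv (𝓡 m) (𝓡 m) e.symm y v = 0 := by
      refine g.nondegenerate _ _ fun w => ?_
      obtain ⟨w', rfl⟩ := hsurj w
      exact hv w'
    exact hinj (h0.trans (map_zero _).symm)

/-- All tangent spaces are the model space, so the base point can be replaced by an equal one
without transporting the vectors. -/
theorem Metric.inner_congr (G : Metric n N) {p q : N} (h : p = q) (u v : Coord n) :
    (G.inner p : Form n) u v = (G.inner q : Form n) u v := by
  subst h; rfl

variable {g : Metric m M} {G : Metric n N} {f : M → N}

theorem contDiffOn_mapInCharts (hf : ContMDiff (𝓡 m) (𝓡 n) ∞ f)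
    {e : OpenPartialHomeomorph M (Coord m)} (he : e ∈ IsManifold.maximalAtlas (𝓡 m) ∞ M)
    {e' : OpenPartialHomeomorph N (Coord n)} (he' : e' ∈ IsManifold.maximalAtlas (𝓡 n) ∞ N) :
    ContDiffOn ℝ ∞ (mapInCharts f e e') (e.target ∩ (f ∘ e.symm) ⁻¹' e'.source) := by
  rw [← contMDiffOn_iff_contDiffOn]
  have h1 : ContMDiffOn (𝓡 m) (𝓡 n) ∞ (f ∘ e.symm) (e.target ∩ (f ∘ e.symm) ⁻¹' e'.source) :=
    hf.comp_contMDiffOn ((contMDiffOn_symm_of_mem_maximalAtlas he).mono Set.inter_subset_left)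
  exact (contMDiffOn_of_mem_maximalAtlas he').comp h1 fun x hx => hx.2

theorem isOpen_mapInCharts (hf : Continuous f) (e : OpenPartialHomeomorph M (Coord m))
    (e' : OpenPartialHomeomorph N (Coord n)) :
    IsOpen (e.target ∩ (f ∘ e.symm) ⁻¹' e'.source) :=
  (hf.comp_continuousOn e.continuousOn_symm).isOpen_inter_preimage e.open_target e'.open_source

/-- Near `x` one has e'⁻¹ ∘ φ = f ∘ e⁻¹. By the chain rule both sides are the ambient product of the
same two vectors at f(e⁻¹ x). -/
theorem isometry_mapInCharts (hf : IsIsometricImmersion g G f)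
    {e : OpenPartialHomeomorph M (Coord m)} (he : e ∈ IsManifold.maximalAtlas (𝓡 m) ∞ M)
    {e' : OpenPartialHomeomorph N (Coord n)} (he' : e' ∈ IsManifold.maximalAtlas (𝓡 n) ∞ N)
    {x : Coord m} (hx : x ∈ e.target ∩ (f ∘ e.symm) ⁻¹' e'.source) (u v : Coord m) :
    G.inChart e' (mapInCharts f e e' x) (fderiv ℝ (mapInCharts f e e') x u)
      (fderiv ℝ (mapInCharts f e e') x v) = g.inChart e x u v := by
  set φ := mapInCharts f e e' with hφ
  have hopen := isOpen_mapInCharts hf.1.continuous e e'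
  have hxe : e'.symm (φ x) = f (e.symm x) := e'.left_inv hx.2
  have hφx : φ x ∈ e'.target := e'.map_source hx.2
  have hφd : MDifferentiableAt (𝓡 m) (𝓡 n) φ x :=
    (((contDiffOn_mapInCharts hf.1 he he').contDiffAt
      (hopen.mem_nhds hx)).differentiableAt (by simp)).mdifferentiableAt
  have he's : MDifferentiableAt (𝓡 n) (𝓡 n) e'.symm (φ x) :=
    ((contMDiffOn_symm_of_mem_maximalAtlas he').contMDiffAt
      (e'.open_target.mem_nhds hφx)).mdifferentiableAt (by simp)
  have hes : MDifferentiableAt (𝓡 m) (𝓡 m) e.symm x :=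
    ((contMDiffOn_symm_of_mem_maximalAtlas he).contMDiffAt
      (e.open_target.mem_nhds hx.1)).mdifferentiableAt (by simp)
  have hfd : MDifferentiableAt (𝓡 m) (𝓡 n) f (e.symm x) :=
    (hf.1 (e.symm x)).mdifferentiableAt (by simp)
  have hD : ∀ u : Coord m,
      (mfderiv (𝓡 n) (𝓡 n) e'.symm (φ x) (fderiv ℝ φ x u) : Coord n)
        = mfderiv (𝓡 m) (𝓡 n) f (e.symm x) (mfderiv (𝓡 m) (𝓡 m) e.symm x u) := by
    intro u
    have c1 := mfderiv_comp x he's hφd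
    have c2 := mfderiv_comp x hfd hes
    have c3 : e'.symm ∘ φ =ᶠ[nhds x] f ∘ e.symm := by
      filter_upwards [hopen.mem_nhds hx] with t ht using e'.left_inv ht.2
    have c4 : mfderiv (𝓡 m) (𝓡 n) (e'.symm ∘ φ) x = mfderiv (𝓡 m) (𝓡 n) (f ∘ e.symm) x :=
      c3.mfderiv_eq
    rw [mfderiv_eq_fderiv] at c1
    have c5 := congrArg (fun T : Coord m →L[ℝ] Coord n => T u) (c1.symm.trans (c4.trans c2))
    exact c5
  rw [Metric.inChart_apply, Metric.inChart_apply, ← hf.2 (e.symm x)]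
  refine (G.inner_congr hxe _ _).trans ?_
  exact congrArg₂ (fun a b => (G.inner (f (e.symm x)) : Form n) a b) (hD u) (hD v)

end Manifold

/-- A hypersurface of a space of constant curvature in local coordinates. -/
theorem isHypersurfaceOn_mapInCharts {m : ℕ} (hm : 1 ≤ m)
    {M : Type*} [TopologicalSpace M] [ChartedSpace (Coord m) M] [IsManifold (𝓡 m) ∞ M]
    {N : Type*} [TopologicalSpace N] [ChartedSpace (Coord (m + 1)) N]
    [IsManifold (𝓡 (m + 1)) ∞ N] {g : Metric m M} {G : Metric (m + 1) N} {f : M → N} {c : ℝ}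
    (hN : G.HasConstantSectionalCurvature c) (hf : IsIsometricImmersion g G f)
    {e : OpenPartialHomeomorph M (Coord m)} (he : e ∈ IsManifold.maximalAtlas (𝓡 m) ∞ M)
    {e' : OpenPartialHomeomorph N (Coord (m + 1))}
    (he' : e' ∈ IsManifold.maximalAtlas (𝓡 (m + 1)) ∞ N) :
    IsHypersurfaceOn (g.inChart e) (G.inChart e') (mapInCharts f e e')
      (e.target ∩ (f ∘ e.symm) ⁻¹' e'.source) e'.target c where
  left := (g.isMetricOn_inChart he).mono (isOpen_mapInCharts hf.1.continuous e e')
    Set.inter_subset_left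
  right := G.isMetricOn_inChart he'
  contDiffOn := contDiffOn_mapInCharts hf.1 he he'
  mapsTo x hx := e'.map_source hx.2
  isometry x hx u v := isometry_mapInCharts hf he he' hx u v
  curvature_eq y hy u v w := (G.isMetricOn_inChart he').curvature_eq_of_const (by omega) hy
    (hN e' he' y hy) u v w

end PseudoRiemannian

theorem corollary4p11
    {M : Type*} [TopologicalSpace M] [ChartedSpace (PseudoRiemannian.Coord 4) M]
    [IsManifold (𝓡 4) ∞ M]
    {N : Type*} [TopologicalSpace N] [ChartedSpace (PseudoRiemannian.Coord 5) N]
    [IsManifold (𝓡 5) ∞ N]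
    (g : PseudoRiemannian.Metric 4 M) (G : PseudoRiemannian.Metric 5 N) (c : ℝ)
    (hN : G.HasConstantSectionalCurvature c)
    (f : M → N) (hf : PseudoRiemannian.IsIsometricImmersion g G f)
    (hbi : PseudoRiemannian.IsBiharmonic g G f)
    (hpc : PseudoRiemannian.HasTwoImaginaryPrincipalCurvatures g G f) :
    PseudoRiemannian.IsMinimal g G f := by
  intro e he e' he' p hp hfp
  have h := PseudoRiemannian.isHypersurfaceOn_mapInCharts (m := 4) (by norm_num) hN hf he he'
  -- The chart hypotheses are stated at points `e p`; every point of the coordinate domain has this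
  -- form with `p = e.symm x`.
  have hmem : ∀ x ∈ e.target ∩ (f ∘ e.symm) ⁻¹' e'.source,
      e.symm x ∈ e.source ∧ f (e.symm x) ∈ e'.source ∧ e (e.symm x) = x := fun x hx =>
    ⟨e.map_target hx.1, hx.2, e.right_inv hx.1⟩
  have hx : e p ∈ e.target ∩ (f ∘ e.symm) ⁻¹' e'.source :=
    ⟨e.map_source hp, by simpa [e.left_inv hp] using hfp⟩
  have h0 := h.tension_eq_zero
    (fun x hx => by
      obtain ⟨h1, h2, h3⟩ := hmem x hx
      have := hbi e he e' he' (e.symm x) h1 h2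
      rwa [h3] at this)
    (fun x hx => by
      obtain ⟨h1, h2, h3⟩ := hmem x hx
      have := hpc e he e' he' (e.symm x) h1 h2
      rwa [h3] at this) hx
  rw [PseudoRiemannian.meanCurvatureVector, h0, smul_zero]
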